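/- Let $M$ be a smooth manifold (without boundary) of dimension $2d$, let $\omega$ be a symplectic form on $M$, i.e. a smooth closed non-degenerate 2-form, and let $f:M\to M$ be a $C^3$ diffeomorphism such that $f^*\omega=a\,\omega$ for a constant $a\in(0,1)$. Let $N\subset M$ be a non-empty closed (i.e. compact, without boundary) embedded $C^3$ submanifold that is invariant, $f(N)=N$, and assume that the induced form $\omega_{|TN}$ has constant rank, i.e. the rank of the bilinear form $\omega_x$ restricted to $T_xN$ is the same integer $\operatorname{rank}(\omega_{|TN})$ for all $x\in N$. Then the topological entropy of $f_{|N}:N\to N$ satisfies $$\operatorname{Ent}(f_{|N})\;\ge\;\frac{\operatorname{rank}(\omega_{|TN})}{2}\,|\log a|.$$ In particular, if $\operatorname{Ent}(f_{|N})=0$, then $N$ is isotropic, i.e. $\omega_x(u,v)=0$ for all $x\in N$ and $u,v\in T_xN$. -/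

import Mathlib

open scoped Manifold ContDiff

noncomputable section

namespace ConformallySymplectic

variable {d : ℕ} {M : Type*} [TopologicalSpace M]
  [ChartedSpace (EuclideanSpace ℝ (Fin (2 * d))) M]

/-- The expression of a differential 2-form `α` on `M` in the chart `extChartAt (𝓡 (2 * d)) x₀`:
the pullback of `α` by the inverse of this chart. It is meaningful on the (open) target of the
chart. -/
def chartForm (α : ∀ x : M, TangentSpace (𝓡 (2 * d)) x [⋀^Fin 2]→L[ℝ] ℝ) (x₀ : M)
    (y : EuclideanSpace ℝ (Fin (2 * d))) :
    EuclideanSpace ℝ (Fin (2 * d)) [⋀^Fin 2]→L[ℝ] ℝ :=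
  (α ((extChartAt (𝓡 (2 * d)) x₀).symm y)).compContinuousLinearMap
    (mfderiv 𝓘(ℝ, EuclideanSpace ℝ (Fin (2 * d))) (𝓡 (2 * d))
      (extChartAt (𝓡 (2 * d)) x₀).symm y)

variable (d M) in
/-- A symplectic form on the `2d`-dimensional manifold `M`: a smooth, closed, non-degenerate
differential 2-form. -/
structure SymplecticForm where
  /-- The underlying field of alternating bilinear forms. -/
  form : ∀ x : M, TangentSpace (𝓡 (2 * d)) x [⋀^Fin 2]→L[ℝ] ℝ
  /-- The form is smooth, that is, its coefficients in charts are smooth. -/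
  smooth : ∀ x₀ : M, ContDiffOn ℝ ∞ (chartForm form x₀) (extChartAt (𝓡 (2 * d)) x₀).target
  /-- The exterior derivative of the form vanishes. -/
  closed : ∀ x₀ : M, ∀ y ∈ (extChartAt (𝓡 (2 * d)) x₀).target,
    extDeriv (chartForm form x₀) y = 0
  /-- The form is non-degenerate at each point. -/
  nondegenerate : ∀ (x : M) (u : TangentSpace (𝓡 (2 * d)) x),
    (∀ v : TangentSpace (𝓡 (2 * d)) x, form x ![u, v] = 0) → u = 0

/-- `f^* Ω = a Ω`. -/
def IsConformallySymplectic (Ω : SymplecticForm d M) (f : M → M) (a : ℝ) : Prop :=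
  ∀ (x : M) (u v : TangentSpace (𝓡 (2 * d)) x),
    Ω.form (f x) ![mfderiv (𝓡 (2 * d)) (𝓡 (2 * d)) f x u,
      mfderiv (𝓡 (2 * d)) (𝓡 (2 * d)) f x v] = a * Ω.form x ![u, v]

/-- A subset `N` of `M`, endowed with its subspace topology and an `n`-dimensional atlas, is an
(embedded) `C^k` submanifold of `M`: the atlas is `C^k` and the inclusion is a `C^k` embedding. -/
structure IsSubmanifold (d : ℕ) {M : Type*} [TopologicalSpace M]
    [ChartedSpace (EuclideanSpace ℝ (Fin (2 * d))) M] (k : ℕ∞ω) (n : ℕ) (N : Set M)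
    [ChartedSpace (EuclideanSpace ℝ (Fin n)) N] : Prop where
  isManifold : IsManifold (𝓡 n) k N
  isSmoothEmbedding :
    Manifold.IsSmoothEmbedding (𝓡 n) (𝓡 (2 * d)) k (Subtype.val : N → M)

/-- The 2-form `Ω|_{TN}` induced on `N`, that is, the pullback of `Ω` by the inclusion of `N`. -/
def inducedForm (Ω : SymplecticForm d M) (n : ℕ) (N : Set M)
    [ChartedSpace (EuclideanSpace ℝ (Fin n)) N] (x : N) :
    TangentSpace (𝓡 n) x [⋀^Fin 2]→L[ℝ] ℝ :=
  (Ω.form (x : M)).compContinuousLinearMap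
    (mfderiv (𝓡 n) (𝓡 (2 * d)) (Subtype.val : N → M) x)

/-- The rank of an alternating bilinear form `α` on `V`: the rank of the linear map
`u ↦ α (u, ·)` from `V` to its dual space. -/
def formRank {V : Type*} [AddCommGroup V] [Module ℝ V] [TopologicalSpace V]
    (α : V [⋀^Fin 2]→L[ℝ] ℝ) : ℕ :=
  Module.finrank ℝ (LinearMap.range α.toAlternatingMap.curryLeft)

/-- `N` is isotropic: `Ω (u, v) = 0` for all `u, v` tangent to `N` at the same point. -/
def IsIsotropic (Ω : SymplecticForm d M) (n : ℕ) (N : Set M)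
    [ChartedSpace (EuclideanSpace ℝ (Fin n)) N] : Prop :=
  ∀ (x : N) (u v : TangentSpace (𝓡 n) x), inducedForm Ω n N x ![u, v] = 0

/-- The topological entropy of a self-map of a compact Hausdorff space, computed with the unique
uniform structure of the space. -/
def topEntropy {X : Type*} [TopologicalSpace X] [CompactSpace X] [T2Space X] (h : X → X) : EReal :=
  @Dynamics.coverEntropy X uniformSpaceOfCompactR1 h Set.univ

/-- The restriction of `f` to an invariant subset `N`. -/
def restrictInvariant {X : Type*} (f : X → X) (N : Set X) (hN : f '' N = N) : N → N :=
  Set.MapsTo.restrict f N N (Set.mapsTo_iff_image_subset.2 hN.subset)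

end ConformallySymplectic

end

/-! The form induced on `N` is closed of constant rank r, so its kernel is tangent to the
characteristic foliation, and the form defines a non-degenerate bilinear form, hence a density
√|det|, on transversals. Since `f` multiplies the form by `a`, it preserves the foliation, and its
inverse multiplies the transverse density by b = a^(-r/2). The entropy bound is a volume-growth
argument for this density.

Fix a small transversal D and consider the points of D whose first m backward iterates stay close to
those of a given point w. If two such points reach the same plaque (local leaf) at time -m, then
pushing forward by `f`, one small plaque at a time, shows that they were in the same plaque at time
0, hence are equal. So the m-th backward iterate, followed by projection to the transverse factor,
is injective on this set. It expands measure by a factor of order b^m and lands in a set of bounded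
measure, so the set has measure O(b^(-m)). Covering D takes at least κ b^m such sets
(`exists_mul_pow_le_card_of_scalesTransverseDensity`), so the entropy is at least log b = (r/2)|log
a| (`log_le_coverEntropy_of_mul_pow_le_card`).

The charts come from `exists_straightening_prod`, a normal form for closed 2-forms of constant rank.
Frobenius is bypassed: one flows out of a transversal along vector fields of the kernel, and by
Cartan's formula the flow preserves the form, so the pulled-back form only sees the transverse
factor. Invariance of the foliation and scaling of the density are then linear algebra
(`IsAdaptedChart.preservesPlaques`, `IsAdaptedChart.scalesTransverseDensity`). Zero entropy forces r
= 0, that is, a vanishing induced form. -/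

section

open Set Metric Filter Topology NNReal

/-! ### Differentiable dependence of a flow on its initial condition -/

section Flow

variable {F : Type*} [NormedAddCommGroup F] [NormedSpace ℝ F]

/-- A quadratic Taylor estimate for a map with Lipschitz derivative. -/
theorem norm_sub_sub_fderiv_le_of_lipschitzOnWith {W : F → F} {s : Set F} {L : ℝ≥0}
    (hs : Convex ℝ s) (hd : ∀ x ∈ s, DifferentiableAt ℝ W x)
    (hL : LipschitzOnWith L (fderiv ℝ W) s) {x y : F} (hx : x ∈ s) (hy : y ∈ s) :
    ‖W y - W x - fderiv ℝ W x (y - x)‖ ≤ L * ‖y - x‖ ^ 2 := by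
  have hseg : segment ℝ x y ⊆ s := hs.segment_subset hx hy
  have := Convex.norm_image_sub_le_of_norm_hasFDerivWithin_le' (f := W) (φ := fderiv ℝ W x)
    (C := L * ‖y - x‖) (s := segment ℝ x y) (f' := fderiv ℝ W)
    (fun z hz => (hd z (hseg hz)).hasFDerivAt.hasFDerivWithinAt)
    (fun z hz => ?_) (convex_segment x y) (left_mem_segment ℝ x y) (right_mem_segment ℝ x y)
  · calc _ ≤ _ := this
      _ = _ := by ring
  · refine (hL.norm_sub_le (hseg hz) hx).trans ?_
    gcongr
    obtain ⟨t, ht, rfl⟩ := segment_eq_image_lineMap ℝ x y ▸ hz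
    rw [AffineMap.lineMap_apply, vsub_eq_sub, vadd_eq_add, add_sub_cancel_right, norm_smul,
      Real.norm_of_nonneg ht.1]
    exact mul_le_of_le_one_left (norm_nonneg _) ht.2

/-- The flow and the solution of the variational equation of a `C²` vector field near a point. -/
theorem exists_flow_and_variation [CompleteSpace F] {W : F → F} {z₀ : F}
    (hW : ContDiffAt ℝ 2 W z₀) {S : Set F} (hS : S ∈ 𝓝 z₀) :
    ∃ δ > (0 : ℝ), ∃ ρ > (0 : ℝ), ∃ φ : F → ℝ → F, ∃ U : F → ℝ → F →L[ℝ] F,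
      (∀ z ∈ ball z₀ ρ, φ z 0 = z ∧ U z 0 = ContinuousLinearMap.id ℝ F ∧
        ∀ t ∈ Icc 0 δ, φ z t ∈ S ∧ ‖U z t‖ ≤ 2 ∧
          HasDerivWithinAt (φ z) (W (φ z t)) (Icc 0 δ) t ∧
          HasDerivWithinAt (U z) ((fderiv ℝ W (φ z t)).comp (U z t)) (Icc 0 δ) t) ∧
      ∀ t ∈ Icc 0 δ, ContinuousOn (fun z => U z t) (ball z₀ ρ) := by
  -- The equation is coupled with its variational equation. As `W` is C², the coupled field is C¹,
  -- so Picard–Lindelöf yields both solutions, jointly continuous in the initial condition.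
  let V : F × (F →L[ℝ] F) → F × (F →L[ℝ] F) := fun q => (W q.1, (fderiv ℝ W q.1).comp q.2)
  let q₀ : F × (F →L[ℝ] F) := (z₀, ContinuousLinearMap.id ℝ F)
  have hV : ContDiffAt ℝ 1 V q₀ := by
    have h1 : ContDiffAt ℝ 1 (fderiv ℝ W) z₀ := hW.fderiv_right (m := 1) (by norm_num)
    have h2 : ContDiffAt ℝ 1 (fun q : F × (F →L[ℝ] F) => fderiv ℝ W q.1) q₀ :=
      ContDiffAt.comp q₀ (g := fderiv ℝ W) h1 contDiffAt_fst
    have h3 : ContDiffAt ℝ 1 (fun q : F × (F →L[ℝ] F) => W q.1) q₀ :=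
      ContDiffAt.comp q₀ (g := W) (hW.of_le (by norm_num)) contDiffAt_fst
    exact h3.prodMk (h2.clm_comp contDiffAt_snd)
  obtain ⟨ε, hε, a, r, Lc, K, hr, hpl⟩ := IsPicardLindelof.of_contDiffAt_one hV
  obtain ⟨α, hα, hαc⟩ :=
    (hpl 0).exists_forall_mem_closedBall_eq_hasDerivWithinAt_continuousOn
  have hr' : (0 : ℝ) < r := hr
  have hcont : ContinuousAt α (q₀, 0) := by
    refine hαc.continuousAt (prod_mem_nhds (closedBall_mem_nhds _ hr') (Icc_mem_nhds ?_ ?_)) <;>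
    simp [hε]
  have hα0 : α (q₀, 0) = q₀ := (hα q₀ (mem_closedBall_self hr'.le)).1
  have hnear : ∀ᶠ p in 𝓝 (q₀, (0 : ℝ)), (α p).1 ∈ S ∧ ‖(α p).2‖ < 2 := by
    have h1 : ContinuousAt (fun p => (α p).1) (q₀, 0) := hcont.fst
    have h2 : ContinuousAt (fun p => ‖(α p).2‖) (q₀, 0) := hcont.snd.norm
    refine (h1.eventually_mem (by rw [hα0]; exact hS)).and
      (h2.eventually_lt continuousAt_const ?_)
    rw [hα0]
    exact ContinuousLinearMap.norm_id_le.trans_lt one_lt_two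
  rw [nhds_prod_eq, Metric.nhds_basis_ball.prod Metric.nhds_basis_ball |>.eventually_iff] at hnear
  obtain ⟨⟨ρ, τ⟩, ⟨hρ, hτ⟩, hnear⟩ := hnear
  simp only at hρ hτ hnear
  have hmem : ∀ {z}, z ∈ ball z₀ (min ρ r) → (z, ContinuousLinearMap.id ℝ F) ∈ closedBall q₀ r ∧
      (z, ContinuousLinearMap.id ℝ F) ∈ ball q₀ ρ := by
    intro z hz
    rw [mem_ball, lt_min_iff] at hz
    constructor
    · rw [mem_closedBall, Prod.dist_eq]; simpa [q₀] using hz.2.le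
    · rw [mem_ball, Prod.dist_eq]; simpa [q₀, hρ] using hz.1
  have hsub : Icc 0 (min (τ / 2) ε) ⊆ Icc (0 - ε) (0 + ε) :=
    Icc_subset_Icc (by linarith) (by simp)
  refine ⟨min (τ / 2) ε, lt_min (by linarith) hε, min ρ r, lt_min hρ hr',
    fun z t => (α ((z, ContinuousLinearMap.id ℝ F), t)).1,
    fun z t => (α ((z, ContinuousLinearMap.id ℝ F), t)).2, ?_, ?_⟩
  · intro z hz
    obtain ⟨h0, hd⟩ := hα _ (hmem hz).1
    refine ⟨congrArg Prod.fst h0, congrArg Prod.snd h0, fun t ht => ?_⟩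
    have hn := @hnear ((z, ContinuousLinearMap.id ℝ F), t) ⟨(hmem hz).2, by
      have := ht.2.trans (min_le_left _ _)
      rw [mem_ball, Real.dist_eq, sub_zero, abs_of_nonneg ht.1]; linarith⟩
    have hdt := (hd t (hsub ht)).mono hsub
    exact ⟨hn.1, hn.2.le, hdt.fst, hdt.snd⟩
  · intro t ht
    have : ContinuousOn (fun z : F => α ((z, ContinuousLinearMap.id ℝ F), t))
        (ball z₀ (min ρ r)) :=
      hαc.comp (by fun_prop) fun z hz => ⟨(hmem hz).1, hsub ht⟩
    exact continuous_snd.comp_continuousOn this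

/-- The local flow of a `C²` vector field is differentiable with respect to the initial condition,
and its derivative solves the variational equation. -/
theorem exists_flow_hasFDerivAt [CompleteSpace F] {W : F → F} {z₀ : F}
    (hW : ContDiffAt ℝ 2 W z₀) {S : Set F} (hS : S ∈ 𝓝 z₀) :
    ∃ δ > (0 : ℝ), ∃ ρ > (0 : ℝ), ∃ φ : F → ℝ → F, ∃ U : F → ℝ → F →L[ℝ] F,
      (∀ z ∈ ball z₀ ρ, φ z 0 = z ∧ U z 0 = ContinuousLinearMap.id ℝ F ∧
        ∀ t ∈ Icc 0 δ, φ z t ∈ S ∧ HasFDerivAt (fun z => φ z t) (U z t) z ∧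
          HasDerivWithinAt (φ z) (W (φ z t)) (Icc 0 δ) t ∧
          HasDerivWithinAt (U z) ((fderiv ℝ W (φ z t)).comp (U z t)) (Icc 0 δ) t) ∧
      ∀ t ∈ Icc 0 δ, ContinuousOn (fun z => U z t) (ball z₀ ρ) := by
  obtain ⟨L, s₁, hs₁, hL⟩ :=
    (hW.fderiv_right (m := 1) (by norm_num)).exists_lipschitzOnWith
  obtain ⟨K, s₂, hs₂, hK⟩ := (hW.of_le (m := 1) (by norm_num)).exists_lipschitzOnWith
  have hd : ∀ᶠ x in 𝓝 z₀, DifferentiableAt ℝ W x :=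
    ((hW.eventually (by simp)).mono fun x hx => hx.differentiableAt (by simp))
  obtain ⟨η, hη, hηs⟩ := Metric.mem_nhds_iff.1 (inter_mem (inter_mem hs₁ hs₂) hd)
  obtain ⟨δ, hδ, ρ, hρ, φ, U, h, hc⟩ := exists_flow_and_variation hW
    (inter_mem hS (ball_mem_nhds z₀ (half_pos hη)))
  refine ⟨δ, hδ, ρ, hρ, φ, U, fun z hz => ?_, hc⟩
  obtain ⟨h0, hU0, hz'⟩ := h z hz
  refine ⟨h0, hU0, fun t ht => ⟨(hz' t ht).1.1, ?_, (hz' t ht).2.2.1, (hz' t ht).2.2.2⟩⟩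
  -- The curve `φ z + U z (z' - z)` is an approximate solution, to second order in `z' - z`.
  have key : ∀ᶠ z' in 𝓝 z, ∀ t ∈ Icc 0 δ,
      ‖φ z' t - φ z t - U z t (z' - z)‖ ≤ gronwallBound 0 K 1 δ * (4 * L * ‖z' - z‖ ^ 2) := by
    -- As ‖U‖ ≤ 2 and `φ z` stays within η/2 of `z₀`, the radius η/4 keeps the approximate solution
    -- in the ball where the Lipschitz bounds hold.
    have hz2 : ∀ᶠ z' in 𝓝 z, z' ∈ ball z₀ ρ ∧ ‖z' - z‖ < η / 4 := by
      refine (isOpen_ball.eventually_mem hz).and ?_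
      have : ContinuousAt (fun z' => ‖z' - z‖) z := by fun_prop
      exact this.eventually_lt continuousAt_const (by simpa using by positivity)
    filter_upwards [hz2] with z' ⟨hz'b, hz'n⟩ t ht
    obtain ⟨h0', -, hφ'⟩ := h z' hz'b
    have hmemb : ∀ t ∈ Icc 0 δ, φ z t + U z t (z' - z) ∈ ball z₀ η := by
      intro t ht
      have h1 := (hz' t ht).1.2
      have h2 : ‖U z t (z' - z)‖ ≤ 2 * ‖z' - z‖ :=
        (U z t).le_of_opNorm_le (hz' t ht).2.1 _
      rw [mem_ball_iff_norm] at h1 ⊢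
      calc ‖φ z t + U z t (z' - z) - z₀‖ = ‖(φ z t - z₀) + U z t (z' - z)‖ := by
            congr 1; abel
        _ ≤ _ := norm_add_le _ _
        _ < η := by linarith
    have hG := dist_le_of_approx_trajectories_ODE_of_mem (v := fun _ => W)
      (s := fun _ => ball z₀ η) (K := K) (f := φ z') (g := fun t => φ z t + U z t (z' - z))
      (f' := fun t => W (φ z' t))
      (g' := fun t => W (φ z t) + fderiv ℝ W (φ z t) (U z t (z' - z))) (a := 0) (b := δ)
      (εf := 0) (εg := 4 * L * ‖z' - z‖ ^ 2) (δ := 0)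
      (fun t _ => hK.mono fun x hx => (hηs hx).1.2)
      (fun t ht => (hφ' t ht).2.2.1.continuousWithinAt)
      (fun t ht => ((hφ' t ⟨ht.1, ht.2.le⟩).2.2.1.mono_of_mem_nhdsWithin
        (Icc_mem_nhdsGE_of_mem ht)))
      (fun t _ => by simp)
      (fun t ht => ball_subset_ball (by linarith) (hφ' t ⟨ht.1, ht.2.le⟩).1.2)
      (fun t ht => ((hz' t ht).2.2.1.continuousWithinAt.add
        ((hz' t ht).2.2.2.continuousWithinAt.clm_apply continuousWithinAt_const)))
      (fun t ht => ?_) (fun t ht => ?_)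
      (fun t ht => hmemb t ⟨ht.1, ht.2.le⟩)
      (by simp [h0, h0', hU0]) t ht
    · rw [dist_eq_norm] at hG
      calc ‖φ z' t - φ z t - U z t (z' - z)‖ = ‖φ z' t - (φ z t + U z t (z' - z))‖ := by
            rw [sub_sub]
        _ ≤ _ := hG
        _ ≤ gronwallBound 0 K (0 + 4 * L * ‖z' - z‖ ^ 2) δ :=
            gronwallBound_mono le_rfl (by positivity) K.2 (by simpa using ht.2)
        _ = _ := by
            unfold gronwallBound
            split_ifs <;> ring
    · have hd1 := (hz' t ⟨ht.1, ht.2.le⟩).2.2.1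
      have hd2 := (hz' t ⟨ht.1, ht.2.le⟩).2.2.2.clm_apply
        (hasDerivWithinAt_const t (Icc 0 δ) (z' - z))
      have := hd1.add hd2
      simp only [map_zero, add_zero, ContinuousLinearMap.comp_apply] at this
      exact this.mono_of_mem_nhdsWithin (Icc_mem_nhdsGE_of_mem ht)
    · have ht' : t ∈ Icc 0 δ := ⟨ht.1, ht.2.le⟩
      have := norm_sub_sub_fderiv_le_of_lipschitzOnWith (W := W) (convex_ball z₀ η)
        (fun x hx => (hηs hx).2) (hL.mono fun x hx => (hηs hx).1.1)
        (ball_subset_ball (by linarith) (hz' t ht').1.2) (hmemb t ht')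
      rw [add_sub_cancel_left] at this
      rw [dist_comm, dist_eq_norm, ← sub_sub]
      refine this.trans ?_
      have h2 : ‖U z t (z' - z)‖ ≤ 2 * ‖z' - z‖ :=
        (U z t).le_of_opNorm_le (hz' t ht').2.1 _
      calc (L : ℝ) * ‖U z t (z' - z)‖ ^ 2 ≤ L * (2 * ‖z' - z‖) ^ 2 := by gcongr
        _ = _ := by ring
  rw [hasFDerivAt_iff_isLittleO]
  have hO : (fun z' => φ z' t - φ z t - U z t (z' - z)) =O[𝓝 z] fun z' => ‖z' - z‖ ^ 2 := by
    refine Asymptotics.IsBigO.of_bound (gronwallBound 0 K 1 δ * (4 * L)) ?_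
    filter_upwards [key] with z' hz'
    refine (hz' t ht).trans_eq ?_
    rw [Real.norm_of_nonneg (by positivity)]; ring
  refine hO.trans_isLittleO ?_
  have : Tendsto (fun z' => z' - z) (𝓝 z) (𝓝 0) := by
    have : ContinuousAt (fun z' => z' - z) z := by fun_prop
    simpa using this.tendsto
  have h2 : (fun h : F => ‖h‖ ^ 2) =o[𝓝 0] fun h => h := by
    simpa using Asymptotics.isLittleO_norm_pow_id (E' := F) one_lt_two
  exact h2.comp_tendsto this

end Flow

/-! ### The kernel of a bilinear form as a graph over the first factor -/

section KernelGraph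

variable {P T : Type*} [NormedAddCommGroup P] [NormedSpace ℝ P]
  [NormedAddCommGroup T] [NormedSpace ℝ T]

/-- Restriction of the second argument of a bilinear form to the second factor. -/
noncomputable def restrictRight (B : P × T →L[ℝ] P × T →L[ℝ] ℝ) : P × T →L[ℝ] T →L[ℝ] ℝ :=
  (ContinuousLinearMap.precomp ℝ (ContinuousLinearMap.inr ℝ P T)).comp B

@[simp]
theorem restrictRight_apply (B : P × T →L[ℝ] P × T →L[ℝ] ℝ) (u : P × T) (t : T) :
    restrictRight B u t = B u (0, t) := by
  simp [restrictRight]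

/-- Restriction of a bilinear form to the second factor. -/
noncomputable def transversePart (B : P × T →L[ℝ] P × T →L[ℝ] ℝ) : T →L[ℝ] T →L[ℝ] ℝ :=
  (restrictRight B).comp (ContinuousLinearMap.inr ℝ P T)

@[simp]
theorem transversePart_apply (B : P × T →L[ℝ] P × T →L[ℝ] ℝ) (s t : T) :
    transversePart B s t = B (0, s) (0, t) := by
  simp [transversePart]

/-- The linear map whose graph is the orthogonal of the second factor, when the form is
non-degenerate on this factor. -/
noncomputable def kernelGraph (B : P × T →L[ℝ] P × T →L[ℝ] ℝ) : P →L[ℝ] T :=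
  -((transversePart B).inverse.comp ((restrictRight B).comp (ContinuousLinearMap.inl ℝ P T)))

theorem restrictRight_kernelGraph {B : P × T →L[ℝ] P × T →L[ℝ] ℝ}
    (hB : (transversePart B).IsInvertible) (p : P) :
    restrictRight B (p, kernelGraph B p) = 0 := by
  have h1 : (p, kernelGraph B p) = (p, (0 : T)) + (0, kernelGraph B p) := by simp
  have h2 : restrictRight B (0, kernelGraph B p) = transversePart B (kernelGraph B p) := by
    simp [transversePart]
  rw [h1, map_add, h2]
  simp only [kernelGraph, neg_apply, ContinuousLinearMap.comp_apply,
    map_neg, hB.self_apply_inverse]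
  simp

theorem finrank_continuousDual [FiniteDimensional ℝ T] :
    Module.finrank ℝ (T →L[ℝ] ℝ) = Module.finrank ℝ T := by
  rw [← (LinearMap.toContinuousLinearMap (𝕜 := ℝ) (E := T) (F' := ℝ)).finrank_eq]
  exact Subspace.dual_finrank_eq

/-- By dimension the kernel is exactly the first factor. A vector of the second factor orthogonal to
that factor is, by antisymmetry, orthogonal to everything, so it lies in the first factor and
vanishes. -/
theorem transversePart_isInvertible [FiniteDimensional ℝ P] [FiniteDimensional ℝ T]
    {B : P × T →L[ℝ] P × T →L[ℝ] ℝ} (hanti : ∀ u v, B u v = -B v u)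
    (hrank : Module.finrank ℝ (LinearMap.ker (B : P × T →ₗ[ℝ] P × T →L[ℝ] ℝ)) =
      Module.finrank ℝ P) (hker : ∀ p v, B (p, 0) v = 0) :
    (transversePart B).IsInvertible := by
  have hle : LinearMap.range (LinearMap.inl ℝ P T) ≤
      LinearMap.ker (B : P × T →ₗ[ℝ] P × T →L[ℝ] ℝ) := by
    rintro _ ⟨p, rfl⟩
    refine ContinuousLinearMap.ext fun v => ?_
    exact hker p v
  have heq := Submodule.eq_of_le_of_finrank_eq hle (by
    rw [hrank, LinearMap.finrank_range_of_inj LinearMap.inl_injective])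
  have hinj : Function.Injective (transversePart B) := by
    rw [injective_iff_map_eq_zero]
    intro t ht
    have : ((0, t) : P × T) ∈ LinearMap.ker (B : P × T →ₗ[ℝ] P × T →L[ℝ] ℝ) := by
      refine ContinuousLinearMap.ext fun v => ?_
      have h1 : v = (v.1, 0) + (0, v.2) := by simp
      have h2 : B (0, t) (0, v.2) = 0 := by
        rw [← transversePart_apply, ht]; rfl
      change B (0, t) v = 0
      rw [h1, map_add, h2, hanti, hker]; simp
    rw [← heq] at this
    obtain ⟨p, hp⟩ := this
    exact (congrArg Prod.snd hp).symm
  exact ⟨(LinearEquiv.ofInjectiveOfFinrankEq (transversePart B : T →ₗ[ℝ] T →L[ℝ] ℝ) hinj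
    finrank_continuousDual.symm).toContinuousLinearEquiv, rfl⟩

/-- The graph is a priori orthogonal to the second factor only. That orthogonal contains the kernel
and, `restrictRight B` being surjective, has the dimension of `P`. The constant-rank hypothesis
makes the two equal. -/
theorem kernelGraph_mem_ker [FiniteDimensional ℝ P] [FiniteDimensional ℝ T]
    {B : P × T →L[ℝ] P × T →L[ℝ] ℝ} (hB : (transversePart B).IsInvertible)
    (hrank : Module.finrank ℝ (LinearMap.ker (B : P × T →ₗ[ℝ] P × T →L[ℝ] ℝ)) =
      Module.finrank ℝ P) (p : P) (v : P × T) :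
    B (p, kernelGraph B p) v = 0 := by
  have hle : LinearMap.ker (B : P × T →ₗ[ℝ] P × T →L[ℝ] ℝ) ≤
      LinearMap.ker (restrictRight B : P × T →ₗ[ℝ] T →L[ℝ] ℝ) := by
    intro u hu
    have hu' : B u = 0 := hu
    change restrictRight B u = 0
    ext t
    simp [hu']
  have hsurj : LinearMap.range (restrictRight B : P × T →ₗ[ℝ] T →L[ℝ] ℝ) = ⊤ := by
    rw [LinearMap.range_eq_top]
    intro l
    obtain ⟨t, ht⟩ := hB.surjective l
    exact ⟨(0, t), ht⟩
  have hdim := LinearMap.finrank_range_add_finrank_ker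
    (restrictRight B : P × T →ₗ[ℝ] T →L[ℝ] ℝ)
  rw [hsurj, finrank_top, finrank_continuousDual, Module.finrank_prod] at hdim
  have heq := Submodule.eq_of_le_of_finrank_eq hle (by omega)
  have : (p, kernelGraph B p) ∈ LinearMap.ker (restrictRight B : P × T →ₗ[ℝ] T →L[ℝ] ℝ) :=
    restrictRight_kernelGraph hB p
  rw [← heq] at this
  have h : B (p, kernelGraph B p) = 0 := this
  rw [h]; rfl

theorem contDiff_transversePart {n : WithTop ℕ∞} :
    ContDiff ℝ n (transversePart : (P × T →L[ℝ] P × T →L[ℝ] ℝ) → _) := by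
  unfold transversePart restrictRight
  fun_prop

theorem contDiffAt_kernelGraph [CompleteSpace T] {n : WithTop ℕ∞}
    {B : P × T →L[ℝ] P × T →L[ℝ] ℝ} (hB : (transversePart B).IsInvertible) :
    ContDiffAt ℝ n (kernelGraph : (P × T →L[ℝ] P × T →L[ℝ] ℝ) → _) B := by
  unfold kernelGraph
  have h1 : ContDiffAt ℝ n (fun B : P × T →L[ℝ] P × T →L[ℝ] ℝ => (transversePart B).inverse) B :=
    ContDiffAt.comp B (g := ContinuousLinearMap.inverse)
      hB.contDiffAt_map_inverse contDiff_transversePart.contDiffAt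
  have h2 : ContDiffAt ℝ n (fun B : P × T →L[ℝ] P × T →L[ℝ] ℝ =>
      (restrictRight B).comp (ContinuousLinearMap.inl ℝ P T)) B := by
    unfold restrictRight
    fun_prop
  exact (h1.clm_comp h2).neg

theorem eventually_isInvertible_transversePart [CompleteSpace T]
    {B : P × T →L[ℝ] P × T →L[ℝ] ℝ} (hB : (transversePart B).IsInvertible) :
    ∀ᶠ B' in 𝓝 B, (transversePart B').IsInvertible := by
  obtain ⟨e, he⟩ := hB
  have h1 := (contDiff_transversePart (P := P) (T := T) (n := 0)).continuous.continuousAt (x := B)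
  have h2 := e.nhds
  rw [he] at h2
  exact (h1.eventually_mem h2).mono fun B' ⟨e', he'⟩ => ⟨e', he'⟩

end KernelGraph

/-! ### Cartan's formula: flows along the kernel preserve a closed form -/

section Invariance

variable {E H : Type*} [NormedAddCommGroup E] [NormedSpace ℝ E]
  [NormedAddCommGroup H] [NormedSpace ℝ H]

/-- The Lie derivative of (the pullback by `q` of) a closed 2-form along a vector field of its
kernel vanishes. -/
theorem lieDeriv_eq_zero_of_mem_ker {α : E → E →L[ℝ] E →L[ℝ] ℝ} (q : H →L[ℝ] E) {W : H → H}
    {z : H} (hα : DifferentiableAt ℝ α (q z)) (hW : DifferentiableAt ℝ W z)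
    (hk : ∀ᶠ z' in 𝓝 z, ∀ v, α (q z') (q (W z')) v = 0)
    (hanti : ∀ u v, α (q z) u v = -α (q z) v u)
    (hcl : ∀ u v w, fderiv ℝ α (q z) u v w - fderiv ℝ α (q z) v u w + fderiv ℝ α (q z) w u v = 0)
    (X Y : H) :
    fderiv ℝ α (q z) (q (W z)) (q X) (q Y) + α (q z) (q (fderiv ℝ W z X)) (q Y) +
      α (q z) (q X) (q (fderiv ℝ W z Y)) = 0 := by
  -- This is the derivative in the direction X of the identity α(W, v) = 0, with v fixed.
  have key : ∀ X v, fderiv ℝ α (q z) (q X) (q (W z)) v + α (q z) (q (fderiv ℝ W z X)) v = 0 := by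
    intro X v
    have h1 : HasFDerivAt (fun z' => α (q z')) ((fderiv ℝ α (q z)).comp q) z :=
      HasFDerivAt.comp z (g := α) hα.hasFDerivAt q.hasFDerivAt
    have h2 : HasFDerivAt (fun z' => q (W z')) (q.comp (fderiv ℝ W z)) z :=
      q.hasFDerivAt.comp z hW.hasFDerivAt
    have h3 := (h1.clm_apply h2).clm_apply (hasFDerivAt_const v z)
    have h4 : HasFDerivAt (fun z' => α (q z') (q (W z')) v) (0 : H →L[ℝ] ℝ) z :=
      (hasFDerivAt_const (0 : ℝ) z).congr_of_eventuallyEq (hk.mono fun z' hz' => hz' v)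
    have h5 := DFunLike.congr_fun (h3.unique h4) X
    simp at h5
    linarith
  have h1 := key X (q Y)
  have h2 := key Y (q X)
  have h3 := hcl (q (W z)) (q X) (q Y)
  have h4 := hanti (q X) (q (fderiv ℝ W z Y))
  have h5 : ∀ w u v, fderiv ℝ α (q z) w u v = fderiv ℝ α (q z) w u v := fun _ _ _ => rfl
  linarith

/-- A closed 2-form is invariant under the flow of a vector field of its kernel. -/
theorem form_flow_eq {α : E → E →L[ℝ] E →L[ℝ] ℝ} (q : H →L[ℝ] E) {W : H → H}
    {δ : ℝ} {φ : ℝ → H} {U : ℝ → H →L[ℝ] H}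
    (hφ : ∀ t ∈ Icc 0 δ, HasDerivWithinAt φ (W (φ t)) (Icc 0 δ) t)
    (hU : ∀ t ∈ Icc 0 δ, HasDerivWithinAt U ((fderiv ℝ W (φ t)).comp (U t)) (Icc 0 δ) t)
    (hα : ∀ t ∈ Icc 0 δ, DifferentiableAt ℝ α (q (φ t)))
    (hW : ∀ t ∈ Icc 0 δ, DifferentiableAt ℝ W (φ t))
    (hk : ∀ t ∈ Icc 0 δ, ∀ᶠ z' in 𝓝 (φ t), ∀ v, α (q z') (q (W z')) v = 0)
    (hanti : ∀ t ∈ Icc 0 δ, ∀ u v, α (q (φ t)) u v = -α (q (φ t)) v u)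
    (hcl : ∀ t ∈ Icc 0 δ, ∀ u v w, fderiv ℝ α (q (φ t)) u v w - fderiv ℝ α (q (φ t)) v u w +
      fderiv ℝ α (q (φ t)) w u v = 0)
    (X Y : H) {t : ℝ} (ht : t ∈ Icc 0 δ) :
    α (q (φ t)) (q (U t X)) (q (U t Y)) = α (q (φ 0)) (q (U 0 X)) (q (U 0 Y)) := by
  have hder : ∀ t ∈ Icc 0 δ, HasDerivWithinAt
      (fun t => α (q (φ t)) (q (U t X)) (q (U t Y))) 0 (Icc 0 δ) t := by
    intro t ht
    have h1 : HasDerivWithinAt (fun t => α (q (φ t))) (fderiv ℝ α (q (φ t)) (q (W (φ t))))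
        (Icc 0 δ) t :=
      HasFDerivAt.comp_hasDerivWithinAt (l := α) t (hα t ht).hasFDerivAt
        (q.hasFDerivAt.comp_hasDerivWithinAt t (hφ t ht))
    have h2 : ∀ X, HasDerivWithinAt (fun t => q (U t X)) (q (fderiv ℝ W (φ t) (U t X)))
        (Icc 0 δ) t := by
      intro X
      have := (hU t ht).clm_apply (hasDerivWithinAt_const t (Icc 0 δ) X)
      simp only [map_zero, add_zero, ContinuousLinearMap.comp_apply] at this
      exact q.hasFDerivAt.comp_hasDerivWithinAt t this
    have h3 := (h1.clm_apply (h2 X)).clm_apply (h2 Y)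
    refine h3.congr_deriv ?_
    rw [← lieDeriv_eq_zero_of_mem_ker q (hα t ht) (hW t ht) (hk t ht) (hanti t ht) (hcl t ht)
      (U t X) (U t Y)]
    simp
  exact constant_of_has_deriv_right_zero (fun t ht => (hder t ht).continuousWithinAt)
    (fun t ht => (hder t ⟨ht.1, ht.2.le⟩).mono_of_mem_nhdsWithin (Icc_mem_nhdsGE_of_mem ht)) t ht

end Invariance

/-! ### Straightening of a closed form of constant rank -/

section Straightening

variable {P T : Type*} [NormedAddCommGroup P] [NormedSpace ℝ P] [FiniteDimensional ℝ P]
  [NormedAddCommGroup T] [NormedSpace ℝ T] [FiniteDimensional ℝ T]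

/-- At a stationary point, where the derivative of the vector field has zero square, the solution
of the variational equation is affine in time. -/
theorem variation_eq_of_fderiv_comp_self {F : Type*} [NormedAddCommGroup F] [NormedSpace ℝ F]
    {D : F →L[ℝ] F} (hD : D.comp D = 0) {δ : ℝ} {U : ℝ → F →L[ℝ] F}
    (h0 : U 0 = ContinuousLinearMap.id ℝ F)
    (hU : ∀ t ∈ Icc 0 δ, HasDerivWithinAt U (D.comp (U t)) (Icc 0 δ) t) {t : ℝ}
    (ht : t ∈ Icc 0 δ) : U t = ContinuousLinearMap.id ℝ F + t • D := by
  have h1 : ∀ t ∈ Icc 0 δ, D.comp (U t) = D := by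
    have hder : ∀ t ∈ Icc 0 δ, HasDerivWithinAt (fun t => D.comp (U t)) 0 (Icc 0 δ) t := by
      intro t ht
      have := (hasDerivWithinAt_const t (Icc 0 δ) D).clm_comp (hU t ht)
      simpa [← ContinuousLinearMap.comp_assoc, hD] using this
    intro t ht
    have := constant_of_has_deriv_right_zero (fun t ht => (hder t ht).continuousWithinAt)
      (fun t ht => (hder t ⟨ht.1, ht.2.le⟩).mono_of_mem_nhdsWithin
        (Icc_mem_nhdsGE_of_mem ht)) t ht
    simpa [h0] using this
  have hder : ∀ t ∈ Icc 0 δ, HasDerivWithinAt (fun t => U t - t • D) 0 (Icc 0 δ) t := by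
    intro t ht
    have := (hU t ht).sub ((hasDerivWithinAt_id t (Icc 0 δ)).smul_const D)
    rw [h1 t ht, one_smul, sub_self] at this
    exact this
  have := constant_of_has_deriv_right_zero (fun t ht => (hder t ht).continuousWithinAt)
    (fun t ht => (hder t ⟨ht.1, ht.2.le⟩).mono_of_mem_nhdsWithin
      (Icc_mem_nhdsGE_of_mem ht)) t ht
  simp only [zero_smul, sub_zero, h0] at this
  rw [← this]; abel

/-- Local normal form of a closed 2-form of constant rank: in suitable `C¹` coordinates, it only
involves the transverse factor. Here the kernel at the base point is the first factor. -/
theorem exists_straightening_prod {α : P × T → P × T →L[ℝ] P × T →L[ℝ] ℝ} {e₀ : P × T}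
    (hα : ContDiffAt ℝ 2 α e₀) (hanti : ∀ y u v, α y u v = -α y v u)
    (hcl : ∀ᶠ y in 𝓝 e₀, ∀ u v w,
      fderiv ℝ α y u v w - fderiv ℝ α y v u w + fderiv ℝ α y w u v = 0)
    (hrank : ∀ᶠ y in 𝓝 e₀, Module.finrank ℝ
      (LinearMap.ker (α y : P × T →ₗ[ℝ] P × T →L[ℝ] ℝ)) = Module.finrank ℝ P)
    (hker : ∀ p v, α e₀ (p, 0) v = 0) :
    ∃ Φ : OpenPartialHomeomorph (P × T) (P × T), ∃ β : P × T → T →L[ℝ] T →L[ℝ] ℝ,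
      0 ∈ Φ.source ∧ Φ 0 = e₀ ∧ ContinuousOn β Φ.source ∧
      ∀ z ∈ Φ.source, Function.Injective (β z) ∧ ∃ Φ' : (P × T) ≃L[ℝ] P × T,
        HasFDerivAt Φ (Φ' : P × T →L[ℝ] P × T) z ∧
        ∀ u v, α (Φ z) (Φ' u) (Φ' v) = β z u.2 v.2 := by
  have hinv₀ : (transversePart (α e₀)).IsInvertible :=
    transversePart_isInvertible (hanti e₀) hrank.self_of_nhds hker
  have hinv : ∀ᶠ y in 𝓝 e₀, (transversePart (α y)).IsInvertible :=
    hα.continuousAt.eventually (eventually_isInvertible_transversePart hinv₀)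
  have hkg : ∀ᶠ y in 𝓝 e₀, ∀ p v, α y (p, kernelGraph (α y) p) v = 0 :=
    (hinv.and hrank).mono fun y hy => kernelGraph_mem_ker hy.1 hy.2
  let G : P × T → P →L[ℝ] T := fun y => kernelGraph (α y)
  have hG : ContDiffAt ℝ 2 G e₀ :=
    ContDiffAt.comp e₀ (g := kernelGraph) (contDiffAt_kernelGraph hinv₀) hα
  -- The first component is a frozen parameter p; the point moves along the kernel field y ↦ (p,
  -- G(y) p). One autonomous flow thus handles all directions of the kernel at once, and no
  -- commutation of these fields is needed.
  let W : P × P × T → P × P × T := fun z => (0, (z.1, G z.2 z.1))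
  have hG₀ : G e₀ = 0 := by
    ext p
    have h : restrictRight (α e₀) (p, 0) = 0 := by ext t; simp [hker]
    simp only [G, kernelGraph, neg_apply, ContinuousLinearMap.comp_apply,
      ContinuousLinearMap.inl_apply, h, map_zero, neg_zero]
    rfl
  have hG2 : ContDiffAt ℝ 2 (fun z : P × P × T => G z.2) (0, e₀) :=
    ContDiffAt.comp ((0, e₀) : P × P × T) (g := G) hG contDiffAt_snd
  have hW : ContDiffAt ℝ 2 W (0, e₀) :=
    contDiffAt_const.prodMk (contDiffAt_fst.prodMk (hG2.clm_apply contDiffAt_fst))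
  let q : P × P × T →L[ℝ] P × T := ContinuousLinearMap.snd ℝ P (P × T)
  -- the set where everything is nice
  have hgood : ∀ᶠ y in 𝓝 e₀, DifferentiableAt ℝ α y ∧
      (∀ u v w, fderiv ℝ α y u v w - fderiv ℝ α y v u w + fderiv ℝ α y w u v = 0) ∧
      ∀ᶠ y' in 𝓝 y, ∀ p v, α y' (p, kernelGraph (α y') p) v = 0 := by
    refine ((hα.eventually (by simp)).mono fun x hx => hx.differentiableAt (by simp)).and
      (hcl.and hkg.eventually_nhds)
  have hS : ∀ᶠ z in 𝓝 ((0, e₀) : P × P × T), DifferentiableAt ℝ W z ∧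
      DifferentiableAt ℝ α (q z) ∧
      (∀ u v w, fderiv ℝ α (q z) u v w - fderiv ℝ α (q z) v u w + fderiv ℝ α (q z) w u v = 0) ∧
      ∀ᶠ z' in 𝓝 z, ∀ v, α (q z') (q (W z')) v = 0 := by
    refine ((hW.eventually (by simp)).mono fun x hx => hx.differentiableAt (by simp)).and ?_
    have hq : Tendsto q (𝓝 ((0, e₀) : P × P × T)) (𝓝 e₀) := q.continuous.continuousAt
    refine (hq.eventually hgood).mono fun z hz => ⟨hz.1, hz.2.1, ?_⟩
    exact (q.continuous.continuousAt.eventually hz.2.2).mono fun z' hz' v => hz' z'.1 v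
  obtain ⟨δ, hδ, ρ, hρ, φ, U, hflow, hUc⟩ := exists_flow_hasFDerivAt hW hS
  have hδm : δ ∈ Icc 0 δ := ⟨hδ.le, le_rfl⟩
  let j : P × T →L[ℝ] P × P × T :=
    (ContinuousLinearMap.fst ℝ P T).prod ((ContinuousLinearMap.inr ℝ P T).comp
      (ContinuousLinearMap.snd ℝ P T))
  -- The image of (p, t) under `Φ` is found by starting on the transversal at e₀ + (0, t) and
  -- flowing for time δ with parameter p.
  let ι : P × T → P × P × T := fun z => (0, e₀) + j z
  have hι : ∀ z, HasFDerivAt ι j z := fun z => j.hasFDerivAt.const_add _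
  have hι0 : ι 0 = (0, e₀) := by simp [ι]
  let Φ : P × T → P × T := fun z => q (φ (ι z) δ)
  let Φ' : P × T → P × T →L[ℝ] P × T := fun z => q.comp ((U (ι z) δ).comp j)
  let O : Set (P × T) := ι ⁻¹' ball (0, e₀) ρ
  have hιc : Continuous ι := continuous_const.add j.continuous
  have hO : IsOpen O := isOpen_ball.preimage hιc
  have h0O : (0 : P × T) ∈ O := by
    change ι 0 ∈ ball _ _
    rw [hι0]; exact mem_ball_self hρ
  have hΦ : ∀ z ∈ O, HasFDerivAt Φ (Φ' z) z := fun z hz =>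
    q.hasFDerivAt.comp z (HasFDerivAt.comp z (g := fun z => φ z δ)
      ((hflow _ hz).2.2 δ hδm).2.1 (hι z))
  have hΦ'c : ContinuousOn Φ' O := by
    have : ContinuousOn (fun z => U (ι z) δ) O := (hUc δ hδm).comp hιc.continuousOn fun z hz => hz
    exact continuousOn_const.clm_comp (this.clm_comp continuousOn_const)
  -- The flow preserves the pullback of α by `q`, so the value can be computed at time 0, where `q`
  -- sends `j u` to (0, u.2).
  have hpull : ∀ z ∈ O, ∀ u v, α (Φ z) (Φ' z u) (Φ' z v) =
      α (q (ι z)) (0, u.2) (0, v.2) := by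
    intro z hz u v
    obtain ⟨h0, hU0, ht⟩ := hflow _ hz
    have := form_flow_eq (α := α) q (W := W) (fun t h => (ht t h).2.2.1)
      (fun t h => (ht t h).2.2.2) (fun t h => (ht t h).1.2.1) (fun t h => (ht t h).1.1)
      (fun t h => (ht t h).1.2.2.2) (fun t h => hanti _) (fun t h => (ht t h).1.2.2.1)
      (j u) (j v) hδm
    rw [h0, hU0] at this
    exact this
  -- the derivative at the base point
  obtain ⟨hφ0, hU0, hφ0t⟩ := hflow (0, e₀) (mem_ball_self hρ)
  have hfst : ∀ t ∈ Icc 0 δ, (φ (0, e₀) t).1 = 0 := by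
    have hder : ∀ t ∈ Icc 0 δ,
        HasDerivWithinAt (fun t => (φ (0, e₀) t).1) 0 (Icc 0 δ) t := fun t ht =>
      (hφ0t t ht).2.2.1.fst
    intro t ht
    have := constant_of_has_deriv_right_zero (fun t ht => (hder t ht).continuousWithinAt)
      (fun t ht => (hder t ⟨ht.1, ht.2.le⟩).mono_of_mem_nhdsWithin
        (Icc_mem_nhdsGE_of_mem ht)) t ht
    rw [this, hφ0]
  have hstat : ∀ t ∈ Icc 0 δ, φ (0, e₀) t = (0, e₀) := by
    have hder : ∀ t ∈ Icc 0 δ, HasDerivWithinAt (φ (0, e₀)) 0 (Icc 0 δ) t := by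
      intro t ht
      have h := (hφ0t t ht).2.2.1
      have h0 : W (φ (0, e₀) t) = 0 := by simp [W, hfst t ht]
      rwa [h0] at h
    intro t ht
    have := constant_of_has_deriv_right_zero (fun t ht => (hder t ht).continuousWithinAt)
      (fun t ht => (hder t ⟨ht.1, ht.2.le⟩).mono_of_mem_nhdsWithin
        (Icc_mem_nhdsGE_of_mem ht)) t ht
    rw [this, hφ0]
  -- Because `G e₀ = 0`, the linearization is (p, y) ↦ (0, (p, 0)), of square zero. The variational
  -- equation then integrates to id + δ D, and `Φ` has the invertible derivative (p, t) ↦ (δ p, t)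
  -- at 0.
  have hDW : HasFDerivAt W ((0 : P × P × T →L[ℝ] P).prod ((ContinuousLinearMap.inl ℝ P T).comp
      (ContinuousLinearMap.fst ℝ P (P × T)))) (0, e₀) := by
    have h1 := (hG2.differentiableAt (by simp)).hasFDerivAt.clm_apply
      (hasFDerivAt_fst (𝕜 := ℝ) (p := ((0, e₀) : P × P × T)))
    have h2 := (hasFDerivAt_const (0 : P) ((0, e₀) : P × P × T)).prodMk
      ((hasFDerivAt_fst (𝕜 := ℝ) (p := ((0, e₀) : P × P × T))).prodMk h1)
    refine h2.congr_fderiv ?_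
    refine ContinuousLinearMap.ext fun x => ?_
    simp [hG₀]
  have hΦ'0 : Φ' 0 = (((ContinuousLinearEquiv.smulLeft (Units.mk0 δ hδ.ne')).prodCongr
      (ContinuousLinearEquiv.refl ℝ T) : (P × T) ≃L[ℝ] P × T) : P × T →L[ℝ] P × T) := by
    have hUδ := variation_eq_of_fderiv_comp_self (F := P × P × T) (D := fderiv ℝ W (0, e₀)) (by
        rw [hDW.fderiv]; refine ContinuousLinearMap.ext fun x => ?_; simp) hU0
      (fun t ht => by simpa [hstat t ht] using (hφ0t t ht).2.2.2) hδm
    refine ContinuousLinearMap.ext fun x => ?_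
    simp only [Φ', hι0, hUδ, hDW.fderiv]
    simp [q, j]
    rfl
  have hstrict : HasStrictFDerivAt Φ (Φ' 0) 0 :=
    hasStrictFDerivAt_of_hasFDerivAt_of_continuousAt
      ((hO.eventually_mem h0O).mono hΦ) (hΦ'c.continuousAt (hO.mem_nhds h0O))
  rw [hΦ'0] at hstrict
  have hΦ0 : Φ 0 = e₀ := by simp [Φ, hι0, hstat δ hδm, q]
  -- shrink the domain
  have hqι : Tendsto (fun z => q (ι z)) (𝓝 0) (𝓝 e₀) := by
    have : ContinuousAt (fun z => q (ι z)) 0 := (q.continuous.comp hιc).continuousAt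
    have h := this.tendsto
    simp only [hι0] at h
    exact h
  have hev : ∀ᶠ z in 𝓝 (0 : P × T), z ∈ O ∧
      (∃ e : (P × T) ≃L[ℝ] P × T, (e : P × T →L[ℝ] P × T) = Φ' z) ∧
      (transversePart (α (q (ι z)))).IsInvertible ∧ ContinuousAt α (q (ι z)) := by
    refine (hO.eventually_mem h0O).and (Eventually.and ?_ (hqι.eventually (hinv.and ?_)))
    · have h := ContinuousLinearEquiv.nhds
        ((ContinuousLinearEquiv.smulLeft (Units.mk0 δ hδ.ne')).prodCongr
          (ContinuousLinearEquiv.refl ℝ T) : (P × T) ≃L[ℝ] P × T)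
      rw [← hΦ'0] at h
      exact (hΦ'c.continuousAt (hO.mem_nhds h0O)).eventually_mem h
    · exact hgood.mono fun y hy => hy.1.continuousAt
  obtain ⟨O', hO'sub, hO', h0O'⟩ := _root_.eventually_nhds_iff.1 hev
  refine ⟨(hstrict.toOpenPartialHomeomorph Φ).restrOpen O' hO',
    fun z => transversePart (α (q (ι z))), ⟨hstrict.mem_toOpenPartialHomeomorph_source, h0O'⟩,
    hΦ0, ?_, ?_⟩
  · intro z hz
    have h1 : ContinuousAt (fun z => α (q (ι z))) z :=
      ContinuousAt.comp (g := α) (f := fun z => q (ι z)) (hO'sub z hz.2).2.2.2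
        (q.continuous.comp hιc).continuousAt
    exact (ContinuousAt.comp (g := transversePart) (f := fun z => α (q (ι z)))
      (contDiff_transversePart (P := P) (T := T) (n := 0)).continuous.continuousAt h1).continuousWithinAt
  · intro z hz
    obtain ⟨hzO, ⟨e, he⟩, hinvz, -⟩ := hO'sub z hz.2
    refine ⟨hinvz.injective, e, ?_, fun u v => ?_⟩
    · rw [he]; exact hΦ z hzO
    · have := hpull z hzO u v
      rw [← he] at this
      simpa using this

end Straightening

end

section

open Set Filter Topology NNReal

/-! ### Plaques along orbits -/

section MapsPlaques

variable {X P T : Type*} [TopologicalSpace P] [TopologicalSpace T]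

/-- `g` sends points of `O` lying in the same plaque of `ψ` to points lying in the same plaque of
`ψ'`. -/
def MapsPlaques [TopologicalSpace X] (ψ ψ' : OpenPartialHomeomorph X (P × T)) (g : X → X)
    (O : Set X) : Prop :=
  ∀ p ∈ O, ∀ q ∈ O, (ψ p).2 = (ψ q).2 → (ψ' (g p)).2 = (ψ' (g q)).2

theorem MapsPlaques.mono [TopologicalSpace X] {ψ ψ' : OpenPartialHomeomorph X (P × T)}
    {g : X → X} {O O' : Set X} (h : MapsPlaques ψ ψ' g O) (hO : O' ⊆ O) :
    MapsPlaques ψ ψ' g O' :=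
  fun p hp q hq => h p (hO hp) q (hO hq)

/-- Points whose backward orbits stay close and end in the same plaque start in the same plaque. -/
theorem plaque_eq_of_iterate_plaque_eq [UniformSpace X] {f : X ≃ₜ X}
    {ψ : X → OpenPartialHomeomorph X (P × T)} {c : X → X} {V : SetRel X X}
    (hmap : ∀ x, MapsPlaques (ψ (c x)) (ψ (c (f x))) f (UniformSpace.ball x V))
    {w p q : X} (m : ℕ)
    (hp : ∀ j ≤ m, f.symm^[j] p ∈ UniformSpace.ball (f.symm^[j] w) V)
    (hq : ∀ j ≤ m, f.symm^[j] q ∈ UniformSpace.ball (f.symm^[j] w) V)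
    (h : (ψ (c (f.symm^[m] w)) (f.symm^[m] p)).2 = (ψ (c (f.symm^[m] w)) (f.symm^[m] q)).2) :
    (ψ (c w) p).2 = (ψ (c w) q).2 := by
  induction m with
  | zero => simpa using h
  | succ m ih =>
    refine ih (fun j hj => hp j (hj.trans m.le_succ)) (fun j hj => hq j (hj.trans m.le_succ)) ?_
    have := hmap (f.symm^[m + 1] w) _ (hp _ le_rfl) _ (hq _ le_rfl) h
    simpa only [Function.iterate_succ_apply', f.apply_symm_apply] using this

end MapsPlaques

/-! ### From infinitesimal to uniform preservation of plaques -/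

section Plaques

variable {X P T : Type*} [NormedAddCommGroup P] [NormedSpace ℝ P]
  [NormedAddCommGroup T] [NormedSpace ℝ T]

/-- Read in the charts `ψ` and `ψ'`, the map `g` is differentiable and its derivative preserves the
first factor. -/
def PreservesPlaques [TopologicalSpace X] (ψ ψ' : OpenPartialHomeomorph X (P × T)) (g : X → X) :
    Prop :=
  ∀ w ∈ ψ.target, g (ψ.symm w) ∈ ψ'.source →
    DifferentiableAt ℝ (fun w => ψ' (g (ψ.symm w))) w ∧
      ∀ p, (fderiv ℝ (fun w => ψ' (g (ψ.symm w))) w (p, 0)).2 = 0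

/-- Read in the charts `ψ` and `ψ'`, the map `g` is differentiable and multiplies by `c` the
transverse density given by `J` and `J'`. -/
def ScalesTransverseDensity [TopologicalSpace X] (ψ ψ' : OpenPartialHomeomorph X (P × T))
    (J J' : P × T → ℝ) (g : X → X) (c : ℝ) : Prop :=
  ∀ w ∈ ψ.target, g (ψ.symm w) ∈ ψ'.source →
    DifferentiableAt ℝ (fun w => ψ' (g (ψ.symm w))) w ∧
      J' (ψ' (g (ψ.symm w))) * |((ContinuousLinearMap.snd ℝ P T).comp
        ((fderiv ℝ (fun w => ψ' (g (ψ.symm w))) w).comp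
          (ContinuousLinearMap.inr ℝ P T))).det| = c * J w

/-- On a slice of a ball by a plaque, which is convex, the transverse coordinate of the image has
zero derivative, so it is constant. -/
theorem PreservesPlaques.exists_nhds [TopologicalSpace X]
    {ψ ψ' : OpenPartialHomeomorph X (P × T)} {g : X → X} (h : PreservesPlaques ψ ψ' g)
    (hg : Continuous g) {z : X} (hz : z ∈ ψ.source) (hgz : g z ∈ ψ'.source) :
    ∃ O ∈ 𝓝 z, MapsPlaques ψ ψ' g O := by
  have hN : IsOpen (ψ.target ∩ ψ.symm ⁻¹' (g ⁻¹' ψ'.source)) :=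
    ψ.isOpen_inter_preimage_symm (ψ'.open_source.preimage hg)
  have hzN : ψ z ∈ ψ.target ∩ ψ.symm ⁻¹' (g ⁻¹' ψ'.source) :=
    ⟨ψ.map_source hz, by simpa [ψ.left_inv hz] using hgz⟩
  obtain ⟨ε, hε, hball⟩ := Metric.isOpen_iff.1 hN _ hzN
  refine ⟨ψ.source ∩ ψ ⁻¹' Metric.ball (ψ z) ε,
    (ψ.isOpen_inter_preimage Metric.isOpen_ball).mem_nhds ⟨hz, Metric.mem_ball_self hε⟩, ?_⟩
  intro p hp q hq hpq
  set τ : P × T → P × T := fun w => ψ' (g (ψ.symm w)) with hτ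
  set t := (ψ p).2 with ht
  let s : Set P := {x | (x, t) ∈ Metric.ball (ψ z) ε}
  have hcont : Continuous fun x : P => (x, t) := by fun_prop
  have hs : IsOpen s := Metric.isOpen_ball.preimage hcont
  have hsc : Convex ℝ s := by
    intro x hx y hy a b ha hb hab
    have := (convex_ball (ψ z) ε) hx hy ha hb hab
    have h2 : a • (x, t) + b • (y, t) = (a • x + b • y, t) := by
      simp [← add_smul, hab]
    rwa [h2] at this
  have hder : ∀ x ∈ s, HasFDerivAt (fun x : P => (τ (x, t)).2) (0 : P →L[ℝ] T) x := by
    intro x hx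
    obtain ⟨hd, hv⟩ := h (x, t) (hball hx).1 (hball hx).2
    have h1 : HasFDerivAt (fun x : P => (x, t)) (ContinuousLinearMap.inl ℝ P T) x := by
      have := (hasFDerivAt_id (𝕜 := ℝ) x).prodMk (hasFDerivAt_const (𝕜 := ℝ) t x)
      exact this.congr_fderiv (by ext <;> simp)
    have h2 := (HasFDerivAt.comp (g := τ) x hd.hasFDerivAt h1).snd
    refine h2.congr_fderiv ?_
    ext v
    simpa using hv v
  have hconst := hs.is_const_of_fderiv_eq_zero hsc.isPreconnected
    (fun x hx => (hder x hx).differentiableAt.differentiableWithinAt)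
    (fun x hx => (hder x hx).fderiv) (x := (ψ p).1) (y := (ψ q).1) hp.2
    (by change ((ψ q).1, t) ∈ Metric.ball (ψ z) ε; rw [hpq]; exact hq.2)
  have e1 : τ ((ψ p).1, t) = ψ' (g p) := by
    rw [hτ]; simp only [ht]; rw [ψ.left_inv hp.1]
  have e2 : τ ((ψ q).1, t) = ψ' (g q) := by
    rw [hτ, hpq]; simp only; rw [ψ.left_inv hq.1]
  simpa only [e1, e2] using hconst

/-- A Lebesgue number for the local neighbourhoods over the compact set `K ∩ g ⁻¹' K'` makes their
size uniform. -/
theorem PreservesPlaques.exists_entourage [UniformSpace X] [T2Space X]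
    {ψ ψ' : OpenPartialHomeomorph X (P × T)} {g : X → X} (h : PreservesPlaques ψ ψ' g)
    (hg : Continuous g) {K K' : Set X} (hK : IsCompact K) (hK' : IsCompact K')
    (hKs : K ⊆ ψ.source) (hKs' : K' ⊆ ψ'.source) :
    ∃ V ∈ uniformity X, ∀ z ∈ K, g z ∈ K' → MapsPlaques ψ ψ' g (UniformSpace.ball z V) := by
  have hc : IsCompact (K ∩ g ⁻¹' K') := hK.inter_right (hK'.isClosed.preimage hg)
  choose! O hO hmap using fun z (hz : z ∈ K ∩ g ⁻¹' K') =>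
    h.exists_nhds hg (hKs hz.1) (hKs' hz.2)
  obtain ⟨V, hV, hVO⟩ := lebesgue_number_lemma_nhds' (U := fun z _ => O z) hc hO
  refine ⟨V, hV, fun z hz hgz => ?_⟩
  obtain ⟨y, hy⟩ := hVO z ⟨hz, hgz⟩
  exact fun p hp q hq => hmap y y.2 p (hy hp) q (hy hq)

/-- A compact space with plaque charts carries finitely many charts and an entourage which is small
with respect to them. -/
theorem exists_adapted_entourage [UniformSpace X] [CompactSpace X] [T2Space X]
    {f : X → X} (hf : Continuous f) (ψ : X → OpenPartialHomeomorph X (P × T))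
    (hψ : ∀ x, x ∈ (ψ x).source) (hid : ∀ x y, PreservesPlaques (ψ x) (ψ y) id)
    (hpf : ∀ x y, PreservesPlaques (ψ x) (ψ y) f) (x₀ : X) :
    ∃ (t : Finset X) (K' : X → Set X) (c : X → X) (V : SetRel X X) (N : Set X),
      x₀ ∈ t ∧ (∀ x, IsCompact (K' x) ∧ K' x ⊆ (ψ x).source) ∧ (∀ x, c x ∈ t) ∧
      V ∈ uniformity X ∧ IsOpen V ∧ V.IsSymm ∧ N ∈ 𝓝 x₀ ∧ N ⊆ K' x₀ ∧
      (∀ x, UniformSpace.ball x V ⊆ K' (c x)) ∧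
      (∀ x, MapsPlaques (ψ (c x)) (ψ (c (f x))) f (UniformSpace.ball x V)) ∧
      (∀ x, ∀ p ∈ UniformSpace.ball x V, p ∈ N →
        MapsPlaques (ψ (c x)) (ψ x₀) id (UniformSpace.ball x V)) := by
  classical
  -- Two nested compact neighbourhoods: the smaller ones `K` cover, and small balls about their
  -- points stay in the larger ones `K'`, inside the chart domains.
  choose K' hK' hK's hK'c using fun x =>
    local_compact_nhds ((ψ x).open_source.mem_nhds (hψ x))
  choose K hK hKs hKc using fun x => local_compact_nhds (interior_mem_nhds.2 (hK' x))
  obtain ⟨t₀, ht₀⟩ := CompactSpace.elim_nhds_subcover K hK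
  let t := insert x₀ t₀
  have hc : ∀ x, ∃ y ∈ t, x ∈ K y := by
    intro x
    have : x ∈ ⋃ y ∈ t₀, K y := by rw [ht₀]; trivial
    obtain ⟨y, hy, hxy⟩ := mem_iUnion₂.1 this
    exact ⟨y, Finset.mem_insert_of_mem hy, hxy⟩
  choose c hct hcK using hc
  choose V₁ hV₁ hV₁K using fun x => lebesgue_number_lemma_nhds' (U := fun _ _ => interior (K' x))
    (hKc x) (fun y hy => isOpen_interior.mem_nhds (hKs x hy))
  choose V₂ hV₂ hV₂f using fun x y =>
    (hpf x y).exists_entourage hf (hK'c x) (hK'c y) (hK's x) (hK's y)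
  choose V₃ hV₃ hV₃f using fun x y =>
    (hid x y).exists_entourage continuous_id (hK'c x) (hK'c y) (hK's x) (hK's y)
  have hV₀ : (⋂ x ∈ t, ⋂ y ∈ t, V₁ x ∩ V₂ x y ∩ V₃ x y) ∈ uniformity X := by
    rw [biInter_finset_mem]
    intro x _
    rw [biInter_finset_mem]
    exact fun y _ => inter_mem (inter_mem (hV₁ x) (hV₂ x y)) (hV₃ x y)
  obtain ⟨V, ⟨hV, hVo, hVs⟩, hVsub⟩ := uniformity_hasBasis_open_symmetric.mem_iff.1 hV₀
  have hVall : ∀ x ∈ t, ∀ y ∈ t, V ⊆ V₁ x ∩ V₂ x y ∩ V₃ x y := fun x hx y hy v hv => by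
    have := mem_iInter₂.1 (mem_iInter₂.1 (hVsub hv) x hx) y hy
    exact this
  have hK'of : ∀ y ∈ t, ∀ x ∈ K y, UniformSpace.ball x V ⊆ K' y := by
    intro y hy x hx
    obtain ⟨-, h⟩ := hV₁K y x hx
    exact (UniformSpace.ball_mono (fun v hv => (hVall y hy y hy hv).1.1) x).trans
      (h.trans interior_subset)
  have hx₀t : x₀ ∈ t := Finset.mem_insert_self _ _
  have hsub : ∀ x, K x ⊆ K' x := fun x => (hKs x).trans interior_subset
  refine ⟨t, K', c, V, K x₀, hx₀t, fun x => ⟨hK'c x, hK's x⟩, hct, hV, hVo, hVs, hK x₀,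
    hsub x₀, fun x => hK'of _ (hct x) x (hcK x), fun x => ?_, fun x p hp hpN => ?_⟩
  · exact (hV₂f _ _ x (hsub _ (hcK x)) (hsub _ (hcK (f x)))).mono
      (UniformSpace.ball_mono (fun v hv => (hVall _ (hct x) _ (hct (f x)) hv).1.2) x)
  -- The centre `x` itself need not be in `K x₀`, but it is V-close to `p`, which is; hence `x` lies
  -- in `K' x₀`.
  · refine (hV₃f _ _ x (hsub _ (hcK x)) (hK'of x₀ hx₀t p hpN ?_)).mono
      (UniformSpace.ball_mono (fun v hv => (hVall _ (hct x) _ hx₀t hv).2) x)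
    exact UniformSpace.mem_ball_symmetry.1 hp

end Plaques

/-! ### Transverse volume growth and entropy -/

section TransverseMeasure

open MeasureTheory

variable {X P T : Type*} [NormedAddCommGroup P] [NormedSpace ℝ P]
  [NormedAddCommGroup T] [NormedSpace ℝ T] [FiniteDimensional ℝ T]
  [MeasurableSpace T] [BorelSpace T] (μ : Measure T) [μ.IsAddHaarMeasure]

/-- A map which scales the transverse densities by `B` and is transversally injective on a piece of
transversal expands the measure of this piece by a factor proportional to `B`. -/
theorem ScalesTransverseDensity.ofReal_mul_measure_le [TopologicalSpace X]
    {ψ ψ' : OpenPartialHomeomorph X (P × T)} {J J' : P × T → ℝ} {g : X → X} {B c C : ℝ}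
    (h : ScalesTransverseDensity ψ ψ' J J' g B) (hB : 0 < B) {p : P}
    {S R : Set T} (hS : MeasurableSet S) (hSt : ∀ t ∈ S, (p, t) ∈ ψ.target)
    (hSg : ∀ t ∈ S, g (ψ.symm (p, t)) ∈ ψ'.source) (hJ : ∀ t ∈ S, c ≤ J (p, t))
    (hJ' : ∀ t ∈ S, 0 < J' (ψ' (g (ψ.symm (p, t)))) ∧ J' (ψ' (g (ψ.symm (p, t)))) ≤ C)
    (hinj : InjOn (fun t => (ψ' (g (ψ.symm (p, t)))).2) S)
    (hR : ∀ t ∈ S, (ψ' (g (ψ.symm (p, t)))).2 ∈ R) :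
    ENNReal.ofReal (B * c / C) * μ S ≤ μ R := by
  set τ : P × T → P × T := fun w => ψ' (g (ψ.symm w)) with hτ
  let D : T → T →L[ℝ] T := fun t => (ContinuousLinearMap.snd ℝ P T).comp
    ((fderiv ℝ τ (p, t)).comp (ContinuousLinearMap.inr ℝ P T))
  have hD : ∀ t ∈ S, HasFDerivWithinAt (fun t => (τ (p, t)).2) (D t) S t := by
    intro t ht
    obtain ⟨hd, -⟩ := h (p, t) (hSt t ht) (hSg t ht)
    have h1 : HasFDerivAt (fun t : T => (p, t)) (ContinuousLinearMap.inr ℝ P T) t := by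
      have := (hasFDerivAt_const (𝕜 := ℝ) p t).prodMk (hasFDerivAt_id (𝕜 := ℝ) t)
      exact this.congr_fderiv (by ext <;> simp)
    exact (HasFDerivAt.comp (g := τ) t hd.hasFDerivAt h1).snd.hasFDerivWithinAt
  calc ENNReal.ofReal (B * c / C) * μ S = ∫⁻ _ in S, ENNReal.ofReal (B * c / C) ∂μ := by
        rw [setLIntegral_const]
    _ ≤ ∫⁻ t in S, ENNReal.ofReal |(D t).det| ∂μ := by
        refine setLIntegral_mono' hS fun t ht => ENNReal.ofReal_le_ofReal ?_
        obtain ⟨-, hdet⟩ := h (p, t) (hSt t ht) (hSg t ht)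
        have hpos := hJ' t ht
        have hC : 0 < C := hpos.1.trans_le hpos.2
        rw [div_le_iff₀ hC]
        calc B * c ≤ B * J (p, t) := by gcongr; exact hJ t ht
          _ = J' (τ (p, t)) * |(D t).det| := hdet.symm
          _ ≤ C * |(D t).det| := by gcongr; exact hpos.2
          _ = _ := mul_comm _ _
    _ = μ ((fun t => (τ (p, t)).2) '' S) :=
        lintegral_abs_det_fderiv_eq_addHaar_image μ hS hD hinj
    _ ≤ μ R := measure_mono (by rintro _ ⟨t, ht, rfl⟩; exact hR t ht)

/-- Exponential lower bound for the cardinality of dynamical covers, when the inverse map expands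
a transverse density of a foliation which it preserves. -/
theorem exists_mul_pow_le_card_of_scalesTransverseDensity [UniformSpace X] [CompactSpace X]
    [T2Space X] [Nonempty X] (f : X ≃ₜ X) (ψ : X → OpenPartialHomeomorph X (P × T))
    (hψ : ∀ x, x ∈ (ψ x).source) (J : X → P × T → ℝ)
    (hJc : ∀ x, ContinuousOn (J x) (ψ x).target) (hJ : ∀ x, ∀ w ∈ (ψ x).target, 0 < J x w)
    (hid : ∀ x y, PreservesPlaques (ψ x) (ψ y) id)
    (hpf : ∀ x y, PreservesPlaques (ψ x) (ψ y) f) {b : ℝ} (hb : 0 < b)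
    (hscale : ∀ (k : ℕ) (x y), ScalesTransverseDensity (ψ x) (ψ y) (J x) (J y)
      (f.symm^[k]) (b ^ k)) :
    ∃ V ∈ uniformity X, ∃ κ > (0 : ℝ), ∀ (m : ℕ) (s : Finset X),
      Dynamics.IsDynCoverOf f univ V (m + 1) s → κ * b ^ m ≤ s.card := by
  obtain ⟨x₀⟩ := ‹Nonempty X›
  obtain ⟨t, K', c, V, N, hx₀, hK', hct, hV, hVo, hVs, hN, hNK, hVK, hmap, hsw⟩ :=
    exists_adapted_entourage f.continuous ψ hψ hid hpf x₀
  let μ : Measure T := Measure.addHaar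
  -- bounds on the densities and on the plaque spaces
  obtain ⟨C, hC⟩ : ∃ C, ∀ x ∈ t, ∀ z ∈ K' x, J x (ψ x z) ≤ C := by
    have : ∀ x, ∃ C, ∀ z ∈ K' x, ‖J x (ψ x z)‖ ≤ C := fun x =>
      (hK' x).1.exists_bound_of_continuousOn (f := fun z => J x (ψ x z))
        ((hJc x).comp ((ψ x).continuousOn.mono (hK' x).2)
          fun z hz => (ψ x).map_source ((hK' x).2 hz))
    choose C hC using this
    obtain ⟨C', hC'⟩ := (t.image C).bddAbove
    exact ⟨C', fun x hx z hz => (le_abs_self _).trans ((hC x z hz).trans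
      (hC' (Finset.mem_coe.2 (Finset.mem_image_of_mem C hx))))⟩
  let R : X → Set T := fun x => Prod.snd '' (ψ x '' K' x)
  have hR : ∀ x, μ (R x) < ⊤ := fun x =>
    (((hK' x).1.image_of_continuousOn ((ψ x).continuousOn.mono (hK' x).2)).image
      continuous_snd).measure_lt_top
  set M : ENNReal := ∑ x ∈ t, μ (R x) with hM
  have hMtop : M < ⊤ := ENNReal.sum_lt_top.2 fun x _ => hR x
  -- a small transversal
  set w₀ := ψ x₀ x₀ with hw₀
  have hw₀t : w₀ ∈ (ψ x₀).target := (ψ x₀).map_source (hψ x₀)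
  let c₀ := J x₀ w₀ / 2
  have hc₀ : 0 < c₀ := half_pos (hJ x₀ w₀ hw₀t)
  have hCpos : 0 < C := by
    have h1 := hC x₀ hx₀ x₀ (hNK (mem_of_mem_nhds hN))
    exact (hJ x₀ w₀ hw₀t).trans_le h1
  let D₁ : Set (P × T) := ((ψ x₀).target ∩ J x₀ ⁻¹' Ioi c₀) ∩
    ((ψ x₀).target ∩ (ψ x₀).symm ⁻¹' interior N)
  have hD₁ : IsOpen D₁ := ((hJc x₀).isOpen_inter_preimage (ψ x₀).open_target isOpen_Ioi).inter
    ((ψ x₀).isOpen_inter_preimage_symm isOpen_interior)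
  have hw₀D : w₀ ∈ D₁ := by
    refine ⟨⟨hw₀t, half_lt_self (hJ x₀ w₀ hw₀t)⟩, hw₀t, ?_⟩
    rw [mem_preimage, hw₀, (ψ x₀).left_inv (hψ x₀)]
    exact mem_interior_iff_mem_nhds.2 hN
  let D : Set T := (fun t => (w₀.1, t)) ⁻¹' D₁
  have hcont : Continuous fun t : T => (w₀.1, t) := by fun_prop
  have hD : IsOpen D := hD₁.preimage hcont
  have hμD : 0 < μ D := hD.measure_pos μ ⟨w₀.2, hw₀D⟩
  let σ : T → X := fun t => (ψ x₀).symm (w₀.1, t)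
  have hσ : ContinuousOn σ D :=
    (ψ x₀).continuousOn_symm.comp hcont.continuousOn fun t ht => ht.1.1
  -- measure of the trace of a Bowen ball on the transversal
  have key : ∀ (m : ℕ) (w : X), ENNReal.ofReal (b ^ m * c₀ / C) *
      μ {t ∈ D | ∀ j ≤ m, f.symm^[j] (σ t) ∈ UniformSpace.ball (f.symm^[j] w) V} ≤ M := by
    intro m w
    set S := {t ∈ D | ∀ j ≤ m, f.symm^[j] (σ t) ∈ UniformSpace.ball (f.symm^[j] w) V} with hS
    have hSo : IsOpen S := by
      have h1 : S = ⋂ j ∈ Iic m,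
          D ∩ (fun t => f.symm^[j] (σ t)) ⁻¹' UniformSpace.ball (f.symm^[j] w) V := by
        ext t
        simp only [hS, mem_ofPred_eq, mem_iInter, mem_inter_iff, mem_preimage, mem_Iic]
        exact ⟨fun h j hj => ⟨h.1, h.2 j hj⟩, fun h => ⟨(h 0 m.zero_le).1, fun j hj => (h j hj).2⟩⟩
      rw [h1]
      refine (finite_Iic m).isOpen_biInter fun j _ => ?_
      exact ((f.symm.continuous.iterate j).comp_continuousOn hσ).isOpen_inter_preimage hD
        (UniformSpace.isOpen_ball _ hVo)
    have hKm : ∀ t ∈ S, f.symm^[m] (σ t) ∈ K' (c (f.symm^[m] w)) := fun t ht =>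
      hVK _ (ht.2 m le_rfl)
    refine ((hscale m x₀ (c (f.symm^[m] w))).ofReal_mul_measure_le (p := w₀.1) (c := c₀)
      (C := C) μ (by positivity) (R := R (c (f.symm^[m] w))) hSo.measurableSet
      (fun t ht => ht.1.1.1) (fun t ht => (hK' _).2 (hKm t ht))
      (fun t ht => le_of_lt ht.1.1.2) (fun t ht => ⟨hJ _ _ ((ψ _).map_source
        ((hK' _).2 (hKm t ht))), hC _ (hct _) _ (hKm t ht)⟩) ?_
      (fun t ht => ⟨_, ⟨_, hKm t ht, rfl⟩, rfl⟩)).trans ?_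
    -- Injectivity: equality of plaques at time -m is carried forward to time 0, then read in the
    -- chart at `x₀`, where `σ t` has transverse coordinate `t`.
    · intro t ht t' ht' heq
      have h1 := plaque_eq_of_iterate_plaque_eq hmap m ht.2 ht'.2 heq
      have h2 := hsw w (σ t) (ht.2 0 m.zero_le) (interior_subset ht.1.2.2) (σ t)
        (ht.2 0 m.zero_le) (σ t') (ht'.2 0 m.zero_le) h1
      simpa [σ, (ψ x₀).right_inv ht.1.1.1, (ψ x₀).right_inv ht'.1.1.1] using h2
    · exact Finset.single_le_sum (f := fun x => μ (R x)) (fun _ _ => zero_le) (hct _)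
  -- Truncating at 1 gives a positive real number without knowing that `μ D` is finite.
  let ν := (min (μ D) 1).toReal
  have hmin : min (μ D) 1 ≠ ⊤ := (min_le_right _ _).trans_lt ENNReal.one_lt_top |>.ne
  have hν : 0 < ν := ENNReal.toReal_pos (lt_min hμD one_pos).ne' hmin
  -- Adding 1 to the total measure spares a proof that it is positive.
  refine ⟨V, hV, c₀ / C * ν / (M.toReal + 1), by positivity, fun m s hs => ?_⟩
  -- Apply the cover to the point at time -m: the forward orbit of length m + 1 from there, read
  -- backwards, is the backward orbit of `σ t`. So the relevant centres are `f^[m] x`.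
  have hcover : D ⊆ ⋃ x ∈ s, {t ∈ D | ∀ j ≤ m,
      f.symm^[j] (σ t) ∈ UniformSpace.ball (f.symm^[j] (f^[m] x)) V} := by
    intro t ht
    obtain ⟨x, hx, hxt⟩ := hs (mem_univ (f.symm^[m] (σ t)))
    refine mem_iUnion₂.2 ⟨x, hx, ht, fun j hj => ?_⟩
    have h1 := Dynamics.mem_dynEntourage.1 hxt (m - j) (by omega)
    have hcancel : ∀ (j : ℕ) (y : X), f.symm^[j] (f^[j] y) = y := fun j =>
      Function.LeftInverse.iterate f.left_inv j
    have hcancel' : ∀ (j : ℕ) (y : X), f^[j] (f.symm^[j] y) = y := fun j =>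
      Function.LeftInverse.iterate f.right_inv j
    have h2 : f.symm^[j] (f^[m] x) = f^[m - j] x := by
      conv_lhs => rw [← Nat.add_sub_cancel' hj, Function.iterate_add_apply, hcancel]
    have h3 : f^[m - j] (f.symm^[m] (σ t)) = f.symm^[j] (σ t) := by
      have h4 : f.symm^[m] (σ t) = f.symm^[m - j] (f.symm^[j] (σ t)) := by
        rw [← Function.iterate_add_apply, Nat.sub_add_cancel hj]
      rw [h4, hcancel']
    rw [h3] at h1
    rw [h2]
    exact UniformSpace.mem_ball_symmetry.1 h1
  have hsum : ENNReal.ofReal (b ^ m * c₀ / C) * μ D ≤ s.card * M := by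
    calc ENNReal.ofReal (b ^ m * c₀ / C) * μ D
        ≤ ENNReal.ofReal (b ^ m * c₀ / C) * ∑ x ∈ s, μ {t ∈ D | ∀ j ≤ m,
          f.symm^[j] (σ t) ∈ UniformSpace.ball (f.symm^[j] (f^[m] x)) V} := by
          gcongr
          exact (measure_mono hcover).trans (measure_biUnion_finset_le _ _)
      _ = ∑ x ∈ s, ENNReal.ofReal (b ^ m * c₀ / C) * μ {t ∈ D | ∀ j ≤ m,
          f.symm^[j] (σ t) ∈ UniformSpace.ball (f.symm^[j] (f^[m] x)) V} := Finset.mul_sum ..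
      _ ≤ ∑ x ∈ s, M := Finset.sum_le_sum fun x _ => key m _
      _ = s.card * M := by rw [Finset.sum_const, nsmul_eq_mul]
  have hreal : b ^ m * c₀ / C * ν ≤ s.card * M.toReal := by
    have h1 : ENNReal.ofReal (b ^ m * c₀ / C) * min (μ D) 1 ≤ s.card * M :=
      le_trans (by gcongr; exact min_le_left _ _) hsum
    have h2 := ENNReal.toReal_mono (ENNReal.mul_ne_top (ENNReal.natCast_ne_top _) hMtop.ne) h1
    rwa [ENNReal.toReal_mul, ENNReal.toReal_mul, ENNReal.toReal_ofReal (by positivity),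
      ENNReal.toReal_natCast] at h2
  have hMn : 0 ≤ M.toReal := ENNReal.toReal_nonneg
  rw [div_mul_eq_mul_div, div_le_iff₀ (by positivity)]
  calc c₀ / C * ν * b ^ m = b ^ m * c₀ / C * ν := by ring
    _ ≤ s.card * M.toReal := hreal
    _ ≤ s.card * (M.toReal + 1) := by gcongr; linarith

/-- Exponential lower bounds for the cardinality of dynamical covers bound the entropy. -/
theorem log_le_coverEntropy_of_mul_pow_le_card [UniformSpace X] {f : X → X} {V : SetRel X X}
    (hV : V ∈ uniformity X) {κ b : ℝ} (hκ : 0 < κ) (hb : 0 < b)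
    (h : ∀ (m : ℕ) (s : Finset X), Dynamics.IsDynCoverOf f univ V (m + 1) s →
      κ * b ^ m ≤ s.card) :
    (Real.log b : EReal) ≤ Dynamics.coverEntropy f univ := by
  refine le_trans ?_ (Dynamics.coverEntropyEntourage_le_coverEntropy f univ hV)
  rw [← ENNReal.log_ofReal_of_pos hb, ← ExpGrowth.expGrowthSup_pow]
  -- Covers of length n = m + 1 are bounded by b^m; dividing κ by b absorbs this shift.
  refine ExpGrowth.expGrowthSup_of_eventually_ge (b := ENNReal.ofReal (κ / b))
    (by simpa using div_pos hκ hb) ?_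
  filter_upwards [eventually_ge_atTop 1] with n hn
  obtain ⟨m, rfl⟩ := Nat.exists_eq_add_of_le' hn
  rw [← ENNReal.ofReal_pow hb.le, ← ENNReal.ofReal_mul (by positivity)]
  have h1 : κ / b * b ^ (m + 1) = κ * b ^ m := by
    rw [pow_succ]; field_simp
  rw [h1]
  by_cases htop : Dynamics.coverMincard f univ V (m + 1) = ⊤
  · rw [htop]; simp
  · obtain ⟨s, hs, hcard⟩ := (Dynamics.coverMincard_finite_iff f univ V (m + 1)).1
      (lt_top_iff_ne_top.2 htop)
    rw [← hcard]
    have := h m s hs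
    rw [ENat.toENNReal_coe, ← ENNReal.ofReal_natCast]
    exact ENNReal.ofReal_le_ofReal this

end TransverseMeasure

/-! ### Alternating 2-forms as bilinear forms -/

section AlternatingForms

variable {E : Type*} [NormedAddCommGroup E] [NormedSpace ℝ E]

variable (E) in
/-- The bilinear form associated with an alternating 2-form. -/
noncomputable def alternatingToBilin : (E [⋀^Fin 2]→L[ℝ] ℝ) →L[ℝ] E →L[ℝ] E →L[ℝ] ℝ :=
  (ContinuousLinearMap.postcomp E ((ContinuousLinearMap.postcomp E
    (ContinuousAlternatingMap.apply ℝ E ℝ ![])).comp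
      (ContinuousAlternatingMap.curryLeftLI (n := 0) (𝕜 := ℝ) (E := E)
        (F := ℝ)).toContinuousLinearMap)).comp
    (ContinuousAlternatingMap.curryLeftLI (n := 1) (𝕜 := ℝ) (E := E)
      (F := ℝ)).toContinuousLinearMap

@[simp]
theorem alternatingToBilin_apply (η : E [⋀^Fin 2]→L[ℝ] ℝ) (u v : E) :
    alternatingToBilin E η u v = η ![u, v] := by
  simp [alternatingToBilin]

theorem alternatingToBilin_antisymm (η : E [⋀^Fin 2]→L[ℝ] ℝ) (u v : E) :
    alternatingToBilin E η u v = -alternatingToBilin E η v u := by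
  have := η.toAlternatingMap.map_swap ![u, v] (i := 0) (j := 1) (by simp)
  have h2 : ![u, v] ∘ Equiv.swap (0 : Fin 2) 1 = ![v, u] := by
    ext i; fin_cases i <;> simp
  rw [h2] at this
  simp only [alternatingToBilin_apply]
  have h3 : η ![v, u] = -η ![u, v] := this
  rw [h3, neg_neg]

/-- The exterior derivative of a 2-form in terms of the derivative of its bilinear form. -/
theorem extDeriv_apply_eq_fderiv_alternatingToBilin {A : E → E [⋀^Fin 2]→L[ℝ] ℝ} {y : E}
    (hA : DifferentiableAt ℝ A y) (u v w : E) :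
    extDeriv A y ![u, v, w] =
      fderiv ℝ (fun y => alternatingToBilin E (A y)) y u v w -
      fderiv ℝ (fun y => alternatingToBilin E (A y)) y v u w +
      fderiv ℝ (fun y => alternatingToBilin E (A y)) y w u v := by
  have hb : HasFDerivAt (fun y => alternatingToBilin E (A y))
      ((alternatingToBilin E).comp (fderiv ℝ A y)) y := by
    have h1 : HasFDerivAt (alternatingToBilin E) (alternatingToBilin E) (A y) :=
      ContinuousLinearMap.hasFDerivAt _
    exact HasFDerivAt.comp (g := alternatingToBilin E) (f := A) y h1 hA.hasFDerivAt
  have hv : ∀ m : Fin 2 → E, HasFDerivAt (fun y => A y m)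
      ((ContinuousAlternatingMap.apply ℝ E ℝ m).comp (fderiv ℝ A y)) y := fun m =>
    (ContinuousAlternatingMap.apply ℝ E ℝ m).hasFDerivAt.comp y hA.hasFDerivAt
  rw [extDeriv_apply hA, hb.fderiv]
  have e0 : (0 : Fin 3).removeNth ![u, v, w] = ![v, w] := by ext i; fin_cases i <;> rfl
  have e1 : (1 : Fin 3).removeNth ![u, v, w] = ![u, w] := by ext i; fin_cases i <;> rfl
  have e2 : (2 : Fin 3).removeNth ![u, v, w] = ![u, v] := by ext i; fin_cases i <;> rfl
  refine (Fin.sum_univ_three _).trans ?_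
  simp only [e0, e1, e2, (hv _).fderiv]
  simp
  ring

/-- The two maps have different codomains but the same kernel, so rank–nullity applies. -/
theorem formRank_eq_finrank_range [FiniteDimensional ℝ E] (η : E [⋀^Fin 2]→L[ℝ] ℝ) :
    ConformallySymplectic.formRank η =
      Module.finrank ℝ (LinearMap.range (alternatingToBilin E η : E →ₗ[ℝ] E →L[ℝ] ℝ)) := by
  unfold ConformallySymplectic.formRank
  have h1 := LinearMap.finrank_range_add_finrank_ker η.toAlternatingMap.curryLeft
  have h2 := LinearMap.finrank_range_add_finrank_ker
    (alternatingToBilin E η : E →ₗ[ℝ] E →L[ℝ] ℝ)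
  have h3 : LinearMap.ker η.toAlternatingMap.curryLeft =
      LinearMap.ker (alternatingToBilin E η : E →ₗ[ℝ] E →L[ℝ] ℝ) := by
    ext u
    simp only [LinearMap.mem_ker]
    constructor
    · intro h
      refine ContinuousLinearMap.ext fun v => ?_
      have := DFunLike.congr_fun h ![v]
      change alternatingToBilin E η u v = 0
      rw [alternatingToBilin_apply]
      exact this
    · intro h
      refine AlternatingMap.ext fun v => ?_
      have h4 : v = ![v 0] := by ext i; fin_cases i; rfl
      have := DFunLike.congr_fun h (v 0)
      change alternatingToBilin E η u (v 0) = 0 at this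
      rw [alternatingToBilin_apply] at this
      rw [h4]
      exact this
  rw [h3] at h1
  omega

end AlternatingForms

/-! ### Linear pullback of bilinear forms -/

section PullBilin

variable {F E : Type*} [NormedAddCommGroup F] [NormedSpace ℝ F]
  [NormedAddCommGroup E] [NormedSpace ℝ E]

/-- Pullback of a bilinear form by a linear map. -/
noncomputable def pullBilin (L : F →L[ℝ] E) : (E →L[ℝ] E →L[ℝ] ℝ) →L[ℝ] F →L[ℝ] F →L[ℝ] ℝ :=
  (ContinuousLinearMap.postcomp F (ContinuousLinearMap.precomp ℝ L)).comp
    (ContinuousLinearMap.precomp (E →L[ℝ] ℝ) L)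

@[simp]
theorem pullBilin_apply (L : F →L[ℝ] E) (B : E →L[ℝ] E →L[ℝ] ℝ) (u v : F) :
    pullBilin L B u v = B (L u) (L v) := by
  simp [pullBilin]

theorem fderiv_pullBilin_apply (L : F →L[ℝ] E) {α : E → E →L[ℝ] E →L[ℝ] ℝ} {z : F}
    (hα : DifferentiableAt ℝ α (L z)) (u v w : F) :
    fderiv ℝ (fun z => pullBilin L (α (L z))) z u v w =
      fderiv ℝ α (L z) (L u) (L v) (L w) := by
  have h1 : HasFDerivAt (fun z => α (L z)) ((fderiv ℝ α (L z)).comp L) z :=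
    HasFDerivAt.comp z (g := α) hα.hasFDerivAt L.hasFDerivAt
  have h2 : HasFDerivAt (pullBilin L) (pullBilin L) (α (L z)) :=
    ContinuousLinearMap.hasFDerivAt _
  have h3 := @HasFDerivAt.comp ℝ _ F _ _ (E →L[ℝ] E →L[ℝ] ℝ) _ _ (F →L[ℝ] F →L[ℝ] ℝ) _ _
    (fun z => α (L z)) ((fderiv ℝ α (L z)).comp L) z (pullBilin L) (pullBilin L) h2 h1
  exact (congrArg (fun l => l u v w) h3.fderiv).trans (pullBilin_apply L _ _ _)

theorem contDiffAt_pullBilin (L : F →L[ℝ] E) {α : E → E →L[ℝ] E →L[ℝ] ℝ} {z : F}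
    {n : WithTop ℕ∞} (hα : ContDiffAt ℝ n α (L z)) :
    ContDiffAt ℝ n (fun z => pullBilin L (α (L z))) z := by
  have h1 : ContDiffAt ℝ n (fun z => α (L z)) z :=
    ContDiffAt.comp z (g := α) hα L.contDiff.contDiffAt
  have h2 : ContDiff ℝ n (pullBilin L) := ContinuousLinearMap.contDiff _
  exact ContDiffAt.comp (g := pullBilin L) (f := fun z => α (L z)) _ h2.contDiffAt h1

theorem finrank_ker_pullBilin (L : F ≃L[ℝ] E) (B : E →L[ℝ] E →L[ℝ] ℝ) :
    Module.finrank ℝ (LinearMap.ker (pullBilin (L : F →L[ℝ] E) B : F →ₗ[ℝ] F →L[ℝ] ℝ)) =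
      Module.finrank ℝ (LinearMap.ker (B : E →ₗ[ℝ] E →L[ℝ] ℝ)) := by
  have : LinearMap.ker (pullBilin (L : F →L[ℝ] E) B : F →ₗ[ℝ] F →L[ℝ] ℝ) =
      (LinearMap.ker (B : E →ₗ[ℝ] E →L[ℝ] ℝ)).comap (L.toLinearEquiv : F →ₗ[ℝ] E) := by
    ext u
    simp only [LinearMap.mem_ker, Submodule.mem_comap]
    constructor
    · intro h
      refine ContinuousLinearMap.ext fun v => ?_
      have := DFunLike.congr_fun h (L.symm v)
      change pullBilin (L : F →L[ℝ] E) B u (L.symm v) = 0 at this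
      rw [pullBilin_apply] at this
      change B (L u) (L (L.symm v)) = 0 at this
      rw [L.apply_symm_apply] at this
      exact this
    · intro h
      refine ContinuousLinearMap.ext fun v => ?_
      have := DFunLike.congr_fun h (L v)
      change pullBilin (L : F →L[ℝ] E) B u v = 0
      rw [pullBilin_apply]
      exact this
  rw [this]
  exact (LinearEquiv.finrank_eq (L.toLinearEquiv.submoduleMap _)).trans
    (by rw [Submodule.map_comap_eq_of_surjective L.toLinearEquiv.surjective])

theorem hasFDerivAt_trans_toOpenPartialHomeomorph {H : Type*} [NormedAddCommGroup H]
    [NormedSpace ℝ H] {Ψ : OpenPartialHomeomorph H F} (L : F ≃L[ℝ] E) {Ψ' : H ≃L[ℝ] F} {z : H}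
    (h : HasFDerivAt Ψ (Ψ' : H →L[ℝ] F) z) :
    HasFDerivAt (Ψ.trans L.toHomeomorph.toOpenPartialHomeomorph)
      (Ψ'.trans L : H →L[ℝ] E) z :=
  HasFDerivAt.comp (g := L) (f := Ψ) z L.hasFDerivAt h

end PullBilin

/-! ### Straightening without a preferred splitting -/

section StraighteningGeneral

variable {P T E : Type*} [NormedAddCommGroup P] [NormedSpace ℝ P] [FiniteDimensional ℝ P]
  [NormedAddCommGroup T] [NormedSpace ℝ T] [FiniteDimensional ℝ T]
  [NormedAddCommGroup E] [NormedSpace ℝ E] [FiniteDimensional ℝ E]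

/-- Local normal form of a closed 2-form of constant rank. -/
theorem exists_straightening {α : E → E →L[ℝ] E →L[ℝ] ℝ} {y₀ : E}
    (hα : ContDiffAt ℝ 2 α y₀) (hanti : ∀ y u v, α y u v = -α y v u)
    (hcl : ∀ᶠ y in 𝓝 y₀, ∀ u v w,
      fderiv ℝ α y u v w - fderiv ℝ α y v u w + fderiv ℝ α y w u v = 0)
    (hrank : ∀ᶠ y in 𝓝 y₀, Module.finrank ℝ
      (LinearMap.range (α y : E →ₗ[ℝ] E →L[ℝ] ℝ)) = Module.finrank ℝ T)
    (hdim : Module.finrank ℝ P + Module.finrank ℝ T = Module.finrank ℝ E) :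
    ∃ Φ : OpenPartialHomeomorph (P × T) E, ∃ β : P × T → T →L[ℝ] T →L[ℝ] ℝ,
      0 ∈ Φ.source ∧ Φ 0 = y₀ ∧ ContinuousOn β Φ.source ∧
      ∀ z ∈ Φ.source, Function.Injective (β z) ∧ ∃ Φ' : (P × T) ≃L[ℝ] E,
        HasFDerivAt Φ (Φ' : P × T →L[ℝ] E) z ∧
        ∀ u v, α (Φ z) (Φ' u) (Φ' v) = β z u.2 v.2 := by
  have hkerdim : ∀ᶠ y in 𝓝 y₀, Module.finrank ℝ
      (LinearMap.ker (α y : E →ₗ[ℝ] E →L[ℝ] ℝ)) = Module.finrank ℝ P := by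
    refine hrank.mono fun y hy => ?_
    have := LinearMap.finrank_range_add_finrank_ker (α y : E →ₗ[ℝ] E →L[ℝ] ℝ)
    omega
  set K := LinearMap.ker (α y₀ : E →ₗ[ℝ] E →L[ℝ] ℝ) with hK
  obtain ⟨K', hKK'⟩ := Submodule.exists_isCompl K
  have hKP : Module.finrank ℝ K = Module.finrank ℝ P := hkerdim.self_of_nhds
  have hK'T : Module.finrank ℝ K' = Module.finrank ℝ T := by
    have := Submodule.finrank_add_eq_of_isCompl hKK'
    omega
  -- A linear change of coordinates carrying the first factor onto the kernel at `y₀` and the second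
  -- onto a complement.
  let L : (P × T) ≃L[ℝ] E := (((LinearEquiv.ofFinrankEq P K hKP.symm).prodCongr
    (LinearEquiv.ofFinrankEq T K' hK'T.symm)).trans
      (Submodule.prodEquivOfIsCompl K K' hKK')).toContinuousLinearEquiv
  have hLK : ∀ p, L (p, 0) ∈ K := by
    intro p
    have : L (p, 0) = (LinearEquiv.ofFinrankEq P K hKP.symm p : E) := by
      simp [L]
    rw [this]; exact Subtype.property _
  let α' : P × T → P × T →L[ℝ] P × T →L[ℝ] ℝ := fun z => pullBilin (L : P × T →L[ℝ] E) (α (L z))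
  have hLt : Tendsto L (𝓝 (L.symm y₀)) (𝓝 y₀) := by
    have := L.continuous.continuousAt (x := L.symm y₀)
    rwa [ContinuousAt, L.apply_symm_apply] at this
  have hdiff : ∀ᶠ y in 𝓝 y₀, DifferentiableAt ℝ α y :=
    (hα.eventually (by simp)).mono fun x hx => hx.differentiableAt (by simp)
  have hLy₀ : L (L.symm y₀) = y₀ := L.apply_symm_apply y₀
  obtain ⟨Ψ, β, h0, hΨ0, hβ, hΨ⟩ := exists_straightening_prod (α := α') (e₀ := L.symm y₀)
    (contDiffAt_pullBilin (L : P × T →L[ℝ] E) (by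
      change ContDiffAt ℝ 2 α (L (L.symm y₀)); rwa [hLy₀]))
    (fun z u v => by rw [pullBilin_apply, pullBilin_apply]; exact hanti _ _ _)
    (by
      filter_upwards [hLt.eventually (hcl.and hdiff)] with z hz u v w
      have h : ∀ u v w, fderiv ℝ α' z u v w = _ :=
        fderiv_pullBilin_apply (L : P × T →L[ℝ] E) (α := α) (z := z) hz.2
      rw [h u v w, h v u w, h w u v]
      exact hz.1 _ _ _)
    (by
      filter_upwards [hLt.eventually hkerdim] with z hz
      rw [← hz]
      exact finrank_ker_pullBilin L _)
    (fun p v => by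
      rw [pullBilin_apply]
      change α (L (L.symm y₀)) (L (p, 0)) (L v) = 0
      rw [hLy₀]
      have : α y₀ (L (p, 0)) = 0 := hLK p
      rw [this]; rfl)
  refine ⟨Ψ.trans L.toHomeomorph.toOpenPartialHomeomorph, β, by simpa using h0,
    by simp [hΨ0], by simpa using hβ, fun z hz => ?_⟩
  have hz' : z ∈ Ψ.source := by simpa using hz
  obtain ⟨hinj, Ψ', hd, heq⟩ := hΨ z hz'
  refine ⟨hinj, Ψ'.trans L, ?_, fun u v => ?_⟩
  · exact hasFDerivAt_trans_toOpenPartialHomeomorph L hd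
  · have := heq u v
    rw [pullBilin_apply] at this
    exact this

end StraighteningGeneral

/-! ### Pullback of 2-forms on manifolds -/

section PullTwoForm

variable {E : Type*} [NormedAddCommGroup E] [NormedSpace ℝ E]
  {H : Type*} [TopologicalSpace H] {I : ModelWithCorners ℝ E H}
  {X : Type*} [TopologicalSpace X] [ChartedSpace H X]
  {E' : Type*} [NormedAddCommGroup E'] [NormedSpace ℝ E']
  {H' : Type*} [TopologicalSpace H'] {J : ModelWithCorners ℝ E' H'}
  {Y : Type*} [TopologicalSpace Y] [ChartedSpace H' Y]
  {E'' : Type*} [NormedAddCommGroup E''] [NormedSpace ℝ E'']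
  {H'' : Type*} [TopologicalSpace H''] {K : ModelWithCorners ℝ E'' H''}
  {Z : Type*} [TopologicalSpace Z] [ChartedSpace H'' Z]

variable (I J) in
/-- The pullback by `F` of a field of alternating 2-forms, evaluated on two tangent vectors. -/
noncomputable def pullTwoForm (η : ∀ y : Y, TangentSpace J y [⋀^Fin 2]→L[ℝ] ℝ) (F : X → Y) (x : X)
    (u v : TangentSpace I x) : ℝ :=
  η (F x) ![mfderiv I J F x u, mfderiv I J F x v]

theorem pullTwoForm_congr (η : ∀ y : Y, TangentSpace J y [⋀^Fin 2]→L[ℝ] ℝ) {F G : X → Y} {x : X}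
    (h : F =ᶠ[𝓝 x] G) (u v : TangentSpace I x) :
    pullTwoForm I J η F x u v = pullTwoForm I J η G x u v := by
  -- Reading every tangent space in the model space removes the dependence of types on the base
  -- point, so base point and derivative can be replaced separately.
  let ev : Y → (E →L[ℝ] E') → ℝ := fun y A =>
    (show E' [⋀^Fin 2]→L[ℝ] ℝ from η y) ![A u, A v]
  change ev (F x) (mfderiv I J F x) = ev (G x) (mfderiv I J G x)
  have h1 : F x = G x := h.self_of_nhds
  have h2 : (mfderiv I J F x : E →L[ℝ] E') = mfderiv I J G x := h.mfderiv_eq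
  exact congr (congrArg ev h1) h2

theorem pullTwoForm_comp (η : ∀ z : Z, TangentSpace K z [⋀^Fin 2]→L[ℝ] ℝ) {G : Y → Z} {F : X → Y}
    {x : X} (hG : MDifferentiableAt J K G (F x)) (hF : MDifferentiableAt I J F x)
    (u v : TangentSpace I x) :
    pullTwoForm I K η (G ∘ F) x u v =
      pullTwoForm J K η G (F x) (mfderiv I J F x u) (mfderiv I J F x v) := by
  unfold pullTwoForm
  rw [mfderiv_comp_apply x hG hF, mfderiv_comp_apply x hG hF]
  rfl

theorem pullTwoForm_comp_of_eq (η : ∀ z : Z, TangentSpace K z [⋀^Fin 2]→L[ℝ] ℝ) {G : Y → Z}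
    {F : X → Y} {x : X} {c : ℝ} (hG : MDifferentiableAt J K G (F x))
    (hF : MDifferentiableAt I J F x) {η' : ∀ y : Y, TangentSpace J y [⋀^Fin 2]→L[ℝ] ℝ}
    (h : ∀ u v, pullTwoForm J K η G (F x) u v = c * η' (F x) ![u, v]) (u v : TangentSpace I x) :
    pullTwoForm I K η (G ∘ F) x u v = c * pullTwoForm I J η' F x u v := by
  rw [pullTwoForm_comp η hG hF, h]
  rfl

theorem pullTwoForm_iterate (η : ∀ x : X, TangentSpace I x [⋀^Fin 2]→L[ℝ] ℝ) {G : X → X} {c : ℝ}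
    (hG : MDifferentiable I I G) (h : ∀ x u v, pullTwoForm I I η G x u v = c * η x ![u, v])
    (k : ℕ) : MDifferentiable I I G^[k] ∧
      ∀ x u v, pullTwoForm I I η G^[k] x u v = c ^ k * η x ![u, v] := by
  induction k with
  | zero =>
    refine ⟨mdifferentiable_id, fun x u v => ?_⟩
    simp only [Function.iterate_zero, pullTwoForm, mfderiv_id, pow_zero, one_mul]
    rfl
  | succ k ih =>
    rw [Function.iterate_succ]
    refine ⟨ih.1.comp hG, fun x u v => ?_⟩
    rw [pullTwoForm_comp_of_eq η (ih.1 _) (hG x) (ih.2 _), h, pow_succ]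
    ring

end PullTwoForm

/-! ### The density of a bilinear form -/

section GramDensity

variable {T : Type*} [NormedAddCommGroup T] [NormedSpace ℝ T]

/-- A continuous bilinear form as an algebraic bilinear form. -/
noncomputable def algBilin (B : T →L[ℝ] T →L[ℝ] ℝ) : LinearMap.BilinForm ℝ T :=
  (ContinuousLinearMap.coeLM ℝ : (T →L[ℝ] ℝ) →ₗ[ℝ] T →ₗ[ℝ] ℝ) ∘ₗ (B : T →ₗ[ℝ] T →L[ℝ] ℝ)

theorem algBilin_apply (B : T →L[ℝ] T →L[ℝ] ℝ) (u v : T) : algBilin B u v = B u v := rfl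

variable [FiniteDimensional ℝ T]

/-- The density `√|det|` of a bilinear form, in a fixed basis. -/
noncomputable def gramDensity (B : T →L[ℝ] T →L[ℝ] ℝ) : ℝ :=
  √|(LinearMap.BilinForm.toMatrix (Module.finBasis ℝ T) (algBilin B)).det|

theorem continuous_gramDensity : Continuous (gramDensity (T := T)) := by
  unfold gramDensity
  refine Real.continuous_sqrt.comp (continuous_abs.comp (Continuous.matrix_det ?_))
  refine continuous_matrix fun i j => ?_
  have h : Continuous fun B : T →L[ℝ] T →L[ℝ] ℝ =>
      B (Module.finBasis ℝ T i) (Module.finBasis ℝ T j) := by fun_prop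
  refine h.congr fun B => ?_
  rw [LinearMap.BilinForm.toMatrix_apply, algBilin_apply]

theorem gramDensity_pos {B : T →L[ℝ] T →L[ℝ] ℝ} (hB : Function.Injective B) :
    0 < gramDensity B := by
  refine Real.sqrt_pos.2 (abs_pos.2 ?_)
  rw [← LinearMap.BilinForm.nondegenerate_iff_det_ne_zero]
  refine LinearMap.BilinForm.Nondegenerate.ofSeparatingLeft fun u hu => hB ?_
  rw [map_zero]
  exact ContinuousLinearMap.ext hu

/-- Taking determinants in Dᵗ B' D = c B gives det B' · (det D)² = c^(dim T) · det B; then take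
square roots of absolute values. -/
theorem gramDensity_mul_abs_det {B B' : T →L[ℝ] T →L[ℝ] ℝ} {c : ℝ} (hc : 0 ≤ c) (D : T →L[ℝ] T)
    (h : ∀ u v, B' (D u) (D v) = c * B u v) :
    gramDensity B' * |D.det| = √c ^ Module.finrank ℝ T * gramDensity B := by
  have h1 : LinearMap.BilinForm.comp (algBilin B') (D : T →ₗ[ℝ] T) (D : T →ₗ[ℝ] T) =
      c • algBilin B := by
    refine LinearMap.BilinForm.ext fun u v => ?_
    exact h u v
  have h2 := congrArg (fun C => (LinearMap.BilinForm.toMatrix (Module.finBasis ℝ T) C).det) h1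
  rw [LinearMap.BilinForm.toMatrix_comp (Module.finBasis ℝ T) (Module.finBasis ℝ T), map_smul,
    Matrix.det_smul, Matrix.det_mul, Matrix.det_mul, Matrix.det_transpose,
    LinearMap.det_toMatrix, Fintype.card_fin] at h2
  unfold gramDensity
  have h3 : |D.det| = √(D.det ^ 2) := (Real.sqrt_sq_eq_abs _).symm
  have h4 : √c ^ Module.finrank ℝ T = √(c ^ Module.finrank ℝ T) := by
    rw [eq_comm, Real.sqrt_eq_iff_mul_self_eq (by positivity) (by positivity), ← mul_pow,
      Real.mul_self_sqrt hc]
  rw [h3, h4, ← Real.sqrt_mul (abs_nonneg _), ← Real.sqrt_mul (pow_nonneg hc _)]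
  congr 1
  rw [← abs_of_nonneg (pow_nonneg hc (Module.finrank ℝ T)), ← abs_mul, ← h2, abs_mul, abs_mul,
    ← sq_abs D.det]
  change _ * |LinearMap.det (D : T →ₗ[ℝ] T)| ^ 2 = _
  ring

end GramDensity

/-! ### Conformal maps in adapted charts -/

section AdaptedChart

variable {E : Type*} [NormedAddCommGroup E] [NormedSpace ℝ E]
  {H : Type*} [TopologicalSpace H] {I : ModelWithCorners ℝ E H}
  {X : Type*} [TopologicalSpace X] [ChartedSpace H X]
  {P T : Type*} [NormedAddCommGroup P] [NormedSpace ℝ P] [NormedAddCommGroup T] [NormedSpace ℝ T]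

variable (I) in
/-- A chart with values in a product `P × T` in which a 2-form only involves the
`T`-components, on which it is non-degenerate. -/
structure IsAdaptedChart (η : ∀ x : X, TangentSpace I x [⋀^Fin 2]→L[ℝ] ℝ)
    (ψ : OpenPartialHomeomorph X (P × T)) (β : P × T → T →L[ℝ] T →L[ℝ] ℝ) : Prop where
  mdifferentiableAt : ∀ x ∈ ψ.source, MDifferentiableAt I 𝓘(ℝ, P × T) ψ x
  mdifferentiableAt_symm : ∀ z ∈ ψ.target, MDifferentiableAt 𝓘(ℝ, P × T) I ψ.symm z
  continuousOn : ContinuousOn β ψ.target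
  injective : ∀ z ∈ ψ.target, Function.Injective (β z)
  pull_eq : ∀ z ∈ ψ.target, ∀ u v : P × T,
    pullTwoForm 𝓘(ℝ, P × T) I η ψ.symm z u v = β z u.2 v.2

variable {η : ∀ x : X, TangentSpace I x [⋀^Fin 2]→L[ℝ] ℝ}
  {ψ ψ' : OpenPartialHomeomorph X (P × T)} {β β' : P × T → T →L[ℝ] T →L[ℝ] ℝ}

/-- Near `z`, the chart expression followed by `ψ'.symm` is `G ∘ ψ.symm`; compare the pullbacks of η
by both sides. -/
theorem IsAdaptedChart.transition (hψ : IsAdaptedChart I η ψ β) (hψ' : IsAdaptedChart I η ψ' β')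
    {G : X → X} (hG : MDifferentiable I I G) {c : ℝ}
    (hc : ∀ x u v, pullTwoForm I I η G x u v = c * η x ![u, v])
    {z : P × T} (hz : z ∈ ψ.target) (hGz : G (ψ.symm z) ∈ ψ'.source) :
    DifferentiableAt ℝ (fun w => ψ' (G (ψ.symm w))) z ∧ ∀ u v,
      β' (ψ' (G (ψ.symm z))) (fderiv ℝ (fun w => ψ' (G (ψ.symm w))) z u).2
        (fderiv ℝ (fun w => ψ' (G (ψ.symm w))) z v).2 = c * β z u.2 v.2 := by
  have h1 := hψ.mdifferentiableAt_symm z hz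
  have h2 : MDifferentiableAt 𝓘(ℝ, P × T) I (G ∘ ψ.symm) z := (hG _).comp z h1
  have h3 : MDifferentiableAt 𝓘(ℝ, P × T) 𝓘(ℝ, P × T) (fun w => ψ' (G (ψ.symm w))) z :=
    (hψ'.mdifferentiableAt _ hGz).comp z h2
  refine ⟨h3.differentiableAt, fun u v => ?_⟩
  have hmem : ψ' (G (ψ.symm z)) ∈ ψ'.target := ψ'.map_source hGz
  have hev : ψ'.symm ∘ (fun w => ψ' (G (ψ.symm w))) =ᶠ[𝓝 z] G ∘ ψ.symm := by
    filter_upwards [h2.continuousAt.preimage_mem_nhds (ψ'.open_source.mem_nhds hGz)] with w hw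
    exact ψ'.left_inv hw
  have h4 := pullTwoForm_congr (I := 𝓘(ℝ, P × T)) η hev u v
  have h5 := pullTwoForm_comp (J := 𝓘(ℝ, P × T)) (F := fun w => ψ' (G (ψ.symm w))) η
    (hψ'.mdifferentiableAt_symm _ hmem) h3 u v
  have h6 := pullTwoForm_comp_of_eq η (hG _) h1 (hc _) u v
  have h7 := h5.symm.trans (h4.trans (h6.trans (congrArg (c * ·) (hψ.pull_eq z hz u v))))
  rw [← mfderiv_eq_fderiv]
  exact (hψ'.pull_eq _ hmem _ _).symm.trans h7

variable [FiniteDimensional ℝ T]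

/-- Non-degeneracy of `β` and c ≠ 0 make the transverse block of the derivative injective, hence
onto. The transverse part of the image of (p, 0) is therefore `β'`-orthogonal to all of `T`, so it
vanishes. -/
theorem IsAdaptedChart.preservesPlaques (hψ : IsAdaptedChart I η ψ β)
    (hψ' : IsAdaptedChart I η ψ' β') {G : X → X} (hG : MDifferentiable I I G) {c : ℝ}
    (hc0 : c ≠ 0) (hc : ∀ x u v, pullTwoForm I I η G x u v = c * η x ![u, v]) :
    PreservesPlaques ψ ψ' G := by
  intro z hz hGz
  obtain ⟨h1, h2⟩ := hψ.transition hψ' hG hc hz hGz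
  refine ⟨h1, fun p => ?_⟩
  set τ := fderiv ℝ (fun w => ψ' (G (ψ.symm w))) z
  let D : T →ₗ[ℝ] T := (LinearMap.snd ℝ P T) ∘ₗ (τ : P × T →ₗ[ℝ] P × T) ∘ₗ LinearMap.inr ℝ P T
  have hD : Function.Injective D := by
    rw [injective_iff_map_eq_zero]
    intro t ht
    refine hψ.injective z hz ?_
    rw [map_zero]
    ext s
    have h3 := h2 (0, t) (0, s)
    have h4 : (τ (0, t)).2 = 0 := ht
    rw [h4, map_zero, zero_apply] at h3
    simpa [hc0] using h3.symm
  have hDs := LinearMap.surjective_of_injective hD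
  refine hψ'.injective _ (ψ'.map_source hGz) ?_
  rw [map_zero]
  ext s
  obtain ⟨t, rfl⟩ := hDs s
  have h3 := h2 (p, 0) (0, t)
  rw [map_zero, zero_apply, mul_zero] at h3
  exact h3

/-- On vectors of the transverse factor, the transition identity says that the transverse block of
the derivative pulls `β'` back to c times `β`. -/
theorem IsAdaptedChart.scalesTransverseDensity (hψ : IsAdaptedChart I η ψ β)
    (hψ' : IsAdaptedChart I η ψ' β') {G : X → X} (hG : MDifferentiable I I G) {c : ℝ}
    (hc0 : 0 ≤ c) (hc : ∀ x u v, pullTwoForm I I η G x u v = c * η x ![u, v]) :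
    ScalesTransverseDensity ψ ψ' (fun z => gramDensity (β z)) (fun z => gramDensity (β' z)) G
      (√c ^ Module.finrank ℝ T) := by
  intro z hz hGz
  obtain ⟨h1, h2⟩ := hψ.transition hψ' hG hc hz hGz
  exact ⟨h1, gramDensity_mul_abs_det hc0 _ fun u v => h2 (0, u) (0, v)⟩

end AdaptedChart

/-! ### Construction of adapted charts -/

section ExistsAdaptedChart

variable {E : Type*} [NormedAddCommGroup E] [NormedSpace ℝ E] [FiniteDimensional ℝ E]
  {X : Type*} [TopologicalSpace X] [ChartedSpace E X] [IsManifold 𝓘(ℝ, E) 1 X]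
  {P T : Type*} [NormedAddCommGroup P] [NormedSpace ℝ P] [FiniteDimensional ℝ P]
  [NormedAddCommGroup T] [NormedSpace ℝ T] [FiniteDimensional ℝ T]

theorem finrank_range_eq_formRank_of_pullTwoForm_chart
    {η : ∀ x : X, TangentSpace 𝓘(ℝ, E) x [⋀^Fin 2]→L[ℝ] ℝ} {x : X} {y : E}
    (hy : y ∈ (chartAt E x).target) {B : E →L[ℝ] E →L[ℝ] ℝ}
    (hB : ∀ u v : E, pullTwoForm 𝓘(ℝ, E) 𝓘(ℝ, E) η (chartAt E x).symm y u v = B u v) :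
    Module.finrank ℝ (LinearMap.range (B : E →ₗ[ℝ] E →L[ℝ] ℝ)) =
      ConformallySymplectic.formRank (η ((chartAt E x).symm y)) := by
  let L : E ≃L[ℝ] E := (mdifferentiable_chart (I := 𝓘(ℝ, E)) x).symm.mfderiv hy
  let η₀ : E [⋀^Fin 2]→L[ℝ] ℝ := η ((chartAt E x).symm y)
  have h1 : B = pullBilin (L : E →L[ℝ] E) (alternatingToBilin E η₀) := by
    ext u v
    rw [pullBilin_apply, alternatingToBilin_apply, ← hB]
    rfl
  change _ = ConformallySymplectic.formRank η₀
  rw [formRank_eq_finrank_range]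
  have h2 := finrank_ker_pullBilin L (alternatingToBilin E η₀)
  rw [← h1] at h2
  have h3 := LinearMap.finrank_range_add_finrank_ker (B : E →ₗ[ℝ] E →L[ℝ] ℝ)
  have h4 := LinearMap.finrank_range_add_finrank_ker
    (alternatingToBilin E η₀ : E →ₗ[ℝ] E →L[ℝ] ℝ)
  omega

theorem exists_isAdaptedChart_of_chart
    {η : ∀ x : X, TangentSpace 𝓘(ℝ, E) x [⋀^Fin 2]→L[ℝ] ℝ} {x : X}
    {α : E → E →L[ℝ] E →L[ℝ] ℝ} (hα : ContDiffAt ℝ 2 α (chartAt E x x))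
    (hanti : ∀ y u v, α y u v = -α y v u)
    (hcl : ∀ᶠ y in 𝓝 (chartAt E x x), ∀ u v w,
      fderiv ℝ α y u v w - fderiv ℝ α y v u w + fderiv ℝ α y w u v = 0)
    (hpull : ∀ᶠ y in 𝓝 (chartAt E x x), ∀ u v : E,
      pullTwoForm 𝓘(ℝ, E) 𝓘(ℝ, E) η (chartAt E x).symm y u v = α y u v)
    (hrank : ∀ x, ConformallySymplectic.formRank (η x) = Module.finrank ℝ T)
    (hdim : Module.finrank ℝ P + Module.finrank ℝ T = Module.finrank ℝ E) :
    ∃ (ψ : OpenPartialHomeomorph X (P × T)) (β : P × T → T →L[ℝ] T →L[ℝ] ℝ),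
      x ∈ ψ.source ∧ IsAdaptedChart 𝓘(ℝ, E) η ψ β := by
  set e := chartAt E x
  have hxe : e x ∈ e.target := mem_chart_target E x
  have htgt : ∀ᶠ y in 𝓝 (e x), y ∈ e.target := e.open_target.mem_nhds hxe
  obtain ⟨Φ, β, h0, hΦ0, hβ, hΦ⟩ := exists_straightening (P := P) (T := T) hα hanti hcl
    (by
      filter_upwards [hpull, htgt] with y hy hyt
      rw [finrank_range_eq_formRank_of_pullTwoForm_chart hyt hy, hrank]) hdim
  obtain ⟨U, hU, hUo, hxU⟩ := eventually_nhds_iff.1 hpull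
  -- The manifold chart followed by the inverse of the straightening, restricted to the open set
  -- where α is known to represent η.
  let ψ : OpenPartialHomeomorph X (P × T) := e.trans (Φ.symm.restrOpen U hUo)
  have hsrc : ∀ q ∈ ψ.source, q ∈ e.source ∧ e q ∈ Φ.target := by
    intro q hq
    have : q ∈ e.source ∧ e q ∈ Φ.target ∧ e q ∈ U := by simpa [ψ] using hq
    exact ⟨this.1, this.2.1⟩
  have ht : ∀ z ∈ ψ.target, z ∈ Φ.source ∧ Φ z ∈ U ∧ Φ z ∈ e.target := by
    intro z hz
    have : (z ∈ Φ.source ∧ Φ z ∈ U) ∧ Φ z ∈ e.target := by simpa [ψ] using hz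
    exact ⟨this.1.1, this.1.2, this.2⟩
  have hψs : ⇑ψ.symm = e.symm ∘ Φ := by ext z; simp [ψ]
  have hψ : ⇑ψ = Φ.symm ∘ e := by ext z <;> simp [ψ]
  refine ⟨ψ, β, ?_, ?_, ?_, hβ.mono fun z hz => (ht z hz).1, fun z hz => (hΦ z (ht z hz).1).1, ?_⟩
  · have h1 : e x ∈ Φ.target := by rw [← hΦ0]; exact Φ.map_source h0
    simpa [ψ] using ⟨mem_chart_source E x, h1, hxU⟩
  · intro q hq
    obtain ⟨h1, h2⟩ := hsrc q hq
    obtain ⟨-, Φ', hd, -⟩ := hΦ (Φ.symm (e q)) (Φ.map_target h2)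
    rw [hψ]
    have h3 : DifferentiableAt ℝ Φ.symm (e q) :=
      (Φ.hasFDerivAt_symm h2 hd).differentiableAt
    exact h3.mdifferentiableAt.comp q (mdifferentiableAt_atlas (chart_mem_atlas E x) h1)
  · intro z hz
    obtain ⟨h1, -, h2⟩ := ht z hz
    obtain ⟨-, Φ', hd, -⟩ := hΦ z h1
    rw [hψs]
    exact (mdifferentiableAt_atlas_symm (chart_mem_atlas E x) h2).comp z
      hd.differentiableAt.mdifferentiableAt
  · intro z hz u v
    obtain ⟨h1, h3, h2⟩ := ht z hz
    obtain ⟨-, Φ', hd, heq⟩ := hΦ z h1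
    have h4 := pullTwoForm_comp (J := 𝓘(ℝ, E)) η (G := e.symm) (F := Φ)
      (mdifferentiableAt_atlas_symm (chart_mem_atlas E x) h2)
      hd.differentiableAt.mdifferentiableAt u v
    rw [mfderiv_eq_fderiv, hd.fderiv] at h4
    rw [hψs, ← heq]
    exact h4.trans (hU _ h3 _ _)

end ExistsAdaptedChart

/-! ### The symplectic form pulled back to a model space -/

section LocalForm

open ConformallySymplectic

variable {d : ℕ} {M : Type*} [TopologicalSpace M]
  [ChartedSpace (EuclideanSpace ℝ (Fin (2 * d))) M] [IsManifold (𝓡 (2 * d)) ∞ M]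
  {E : Type*} [NormedAddCommGroup E] [NormedSpace ℝ E]

theorem contDiffAt_alternatingToBilin_pullback {E' : Type*} [NormedAddCommGroup E']
    [NormedSpace ℝ E'] {B : E → E' [⋀^Fin 2]→L[ℝ] ℝ} {D : E → E →L[ℝ] E'} {y : E}
    {n : WithTop ℕ∞} (hB : ContDiffAt ℝ n B y) (hD : ContDiffAt ℝ n D y) :
    ContDiffAt ℝ n
      (fun y => alternatingToBilin E ((B y).compContinuousLinearMap (D y))) y := by
  have h1 : ContDiffAt ℝ n (fun y => alternatingToBilin E' (B y)) y := by
    have h : ContDiff ℝ n (alternatingToBilin E') := ContinuousLinearMap.contDiff _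
    exact ContDiffAt.comp (g := alternatingToBilin E') (f := B) _ h.contDiffAt hB
  have h2 : ContDiffAt ℝ n (fun y => ((ContinuousLinearMap.compL ℝ E E' ℝ).flip (D y)).comp
      ((alternatingToBilin E' (B y)).comp (D y))) y := by
    refine ContDiffAt.clm_comp ?_ (h1.clm_comp hD)
    have h : ContDiff ℝ n (ContinuousLinearMap.compL ℝ E E' ℝ).flip :=
      ContinuousLinearMap.contDiff _
    exact ContDiffAt.comp (g := (ContinuousLinearMap.compL ℝ E E' ℝ).flip) (f := D) _
      h.contDiffAt hD
  refine h2.congr_of_eventuallyEq (Eventually.of_forall fun y => ?_)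
  ext u v
  simp only [alternatingToBilin_apply]
  have : ⇑(D y) ∘ ![u, v] = ![D y u, D y v] := by
    ext i; fin_cases i <;> rfl
  simp [this]

/-- In a chart of M, the map `F` becomes a C³ map g, and α is the pullback by g of the chart
expression of the form. It is C² because it involves one derivative of g, and closed because d
commutes with pullback. -/
theorem ConformallySymplectic.SymplecticForm.exists_local_pullback (Ω : SymplecticForm d M)
    {F : E → M} {y₀ : E} (hF : ContMDiffAt 𝓘(ℝ, E) (𝓡 (2 * d)) 3 F y₀) :
    ∃ α : E → E →L[ℝ] E →L[ℝ] ℝ, ContDiffAt ℝ 2 α y₀ ∧ (∀ y u v, α y u v = -α y v u) ∧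
      (∀ᶠ y in 𝓝 y₀, ∀ u v w,
        fderiv ℝ α y u v w - fderiv ℝ α y v u w + fderiv ℝ α y w u v = 0) ∧
      ∀ᶠ y in 𝓝 y₀, ∀ u v : E,
        pullTwoForm 𝓘(ℝ, E) (𝓡 (2 * d)) Ω.form F y u v = α y u v := by
  set φ := extChartAt (𝓡 (2 * d)) (F y₀)
  set g : E → EuclideanSpace ℝ (Fin (2 * d)) := φ ∘ F
  have hφo : IsOpen φ.target := isOpen_extChartAt_target _
  have hg : ContDiffAt ℝ 3 g y₀ := by
    have h1 : ContMDiffAt (𝓡 (2 * d)) 𝓘(ℝ, EuclideanSpace ℝ (Fin (2 * d))) 3 φ (F y₀) :=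
      contMDiffAt_extChartAt' (n := ∞) (mem_chart_source _ _) |>.of_le (ENat.LEInfty.out)
    exact (h1.comp y₀ hF).contDiffAt
  have hgev : ∀ᶠ y in 𝓝 y₀, ContDiffAt ℝ 3 g y := hg.eventually (by simp)
  have hsrc : ∀ᶠ y in 𝓝 y₀, F y ∈ φ.source :=
    hF.continuousAt.preimage_mem_nhds (extChartAt_source_mem_nhds _)
  have hsrc' : ∀ᶠ y in 𝓝 y₀, ∀ᶠ w in 𝓝 y, F w ∈ φ.source := hsrc.eventually_nhds
  have htgt : ∀ᶠ y in 𝓝 y₀, g y ∈ φ.target := hsrc.mono fun y hy => φ.map_source hy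
  have hΩ : ∀ z ∈ φ.target, ContDiffAt ℝ 2 (chartForm Ω.form (F y₀)) z := fun z hz =>
    ((Ω.smooth (F y₀)).contDiffAt (hφo.mem_nhds hz)).of_le (ENat.LEInfty.out)
  have hΩg : ∀ y, ContDiffAt ℝ 3 g y → g y ∈ φ.target →
      ContDiffAt ℝ 2 (fun y => chartForm Ω.form (F y₀) (g y)) y := fun y h1 h2 =>
    (hΩ _ h2).comp y (h1.of_le (by norm_num))
  refine ⟨fun y => alternatingToBilin E
    ((chartForm Ω.form (F y₀) (g y)).compContinuousLinearMap (fderiv ℝ g y)),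
    contDiffAt_alternatingToBilin_pullback (hΩg _ hg htgt.self_of_nhds)
      (hg.fderiv_right (by norm_num)), fun y u v => alternatingToBilin_antisymm _ u v, ?_, ?_⟩
  · filter_upwards [hgev, htgt] with y hy hyt u v w
    have hA : DifferentiableAt ℝ
        (fun y => (chartForm Ω.form (F y₀) (g y)).compContinuousLinearMap (fderiv ℝ g y)) y :=
      (HasFDerivAt.continuousAlternatingMapCompContinuousLinearMap
        ((hΩg y hy hyt).differentiableAt (by simp)).hasFDerivAt
        ((hy.fderiv_right (m := 2) (by norm_num)).differentiableAt
          (by simp)).hasFDerivAt).differentiableAt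
    rw [← extDeriv_apply_eq_fderiv_alternatingToBilin hA,
      extDeriv_pullback ((hΩ _ hyt).differentiableAt (by simp)) hy
        (by simp only [minSmoothness_of_isRCLikeNormedField]; norm_num),
      Ω.closed _ _ hyt]
    simp
  · filter_upwards [hgev, hsrc', htgt] with y hy hys hyt u v
    have hFy : F =ᶠ[𝓝 y] φ.symm ∘ g := hys.mono fun w hw => (φ.left_inv hw).symm
    have h1 := pullTwoForm_congr (I := 𝓘(ℝ, E)) Ω.form hFy u v
    have hgy : DifferentiableAt ℝ g y := hy.differentiableAt (by simp)
    have hφy : MDifferentiableAt 𝓘(ℝ, EuclideanSpace ℝ (Fin (2 * d))) (𝓡 (2 * d)) φ.symm (g y) :=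
      ((contMDiffOn_extChartAt_symm (I := 𝓡 (2 * d)) (n := ∞) (F y₀)).contMDiffAt
        (hφo.mem_nhds hyt)).mdifferentiableAt (by simp)
    have h2 := pullTwoForm_comp (J := 𝓘(ℝ, EuclideanSpace ℝ (Fin (2 * d)))) Ω.form hφy
      hgy.mdifferentiableAt u v
    rw [mfderiv_eq_fderiv] at h2
    refine (h1.trans h2).trans ?_
    rw [alternatingToBilin_apply]
    have : ⇑(fderiv ℝ g y) ∘ ![u, v] = ![fderiv ℝ g y u, fderiv ℝ g y v] := by
      ext i; fin_cases i <;> rfl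
    rw [ContinuousAlternatingMap.compContinuousLinearMap_apply, this]
    have h3 : ⇑(mfderiv 𝓘(ℝ, EuclideanSpace ℝ (Fin (2 * d))) (𝓡 (2 * d)) φ.symm (g y)) ∘
        ![fderiv ℝ g y u, fderiv ℝ g y v] =
        ![mfderiv 𝓘(ℝ, EuclideanSpace ℝ (Fin (2 * d))) (𝓡 (2 * d)) φ.symm (g y) (fderiv ℝ g y u),
          mfderiv 𝓘(ℝ, EuclideanSpace ℝ (Fin (2 * d))) (𝓡 (2 * d)) φ.symm (g y)
            (fderiv ℝ g y v)] := by
      funext i; fin_cases i <;> rfl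
    exact (congrArg (Ω.form (φ.symm (g y))) h3).symm

end LocalForm

/-! ### Entropy bound for a form with adapted charts -/

section EntropyBound

variable {E : Type*} [NormedAddCommGroup E] [NormedSpace ℝ E]
  {X : Type*} [UniformSpace X] [CompactSpace X] [T2Space X] [Nonempty X] [ChartedSpace E X]
  {P T : Type*} [NormedAddCommGroup P] [NormedSpace ℝ P]
  [NormedAddCommGroup T] [NormedSpace ℝ T] [FiniteDimensional ℝ T]

/-- Entropy bound for a diffeomorphism of a compact manifold which contracts by a factor `a` a
2-form having adapted charts. -/
theorem le_coverEntropy_of_pullTwoForm_eq {η : ∀ x : X, TangentSpace 𝓘(ℝ, E) x [⋀^Fin 2]→L[ℝ] ℝ}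
    (hη : ∀ x, ∃ (ψ : OpenPartialHomeomorph X (P × T)) (β : P × T → T →L[ℝ] T →L[ℝ] ℝ),
      x ∈ ψ.source ∧ IsAdaptedChart 𝓘(ℝ, E) η ψ β)
    (f : X ≃ₜ X) (hf : MDifferentiable 𝓘(ℝ, E) 𝓘(ℝ, E) f)
    (hf' : MDifferentiable 𝓘(ℝ, E) 𝓘(ℝ, E) f.symm) {a : ℝ} (ha : a ∈ Ioo (0 : ℝ) 1)
    (hfη : ∀ x u v, pullTwoForm 𝓘(ℝ, E) 𝓘(ℝ, E) η f x u v = a * η x ![u, v])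
    (hfη' : ∀ x u v, pullTwoForm 𝓘(ℝ, E) 𝓘(ℝ, E) η f.symm x u v = a⁻¹ * η x ![u, v]) :
    (((Module.finrank ℝ T : ℝ) / 2 * |Real.log a| : ℝ) : EReal) ≤
      Dynamics.coverEntropy f univ := by
  choose ψ β hψ hβ using hη
  have ha0 : 0 < a⁻¹ := inv_pos.2 ha.1
  let _ : MeasurableSpace T := borel T
  have : BorelSpace T := ⟨rfl⟩
  set b := √a⁻¹ ^ Module.finrank ℝ T with hb
  have hbpos : 0 < b := pow_pos (Real.sqrt_pos.2 ha0) _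
  obtain ⟨V, hV, κ, hκ, hcard⟩ := exists_mul_pow_le_card_of_scalesTransverseDensity f ψ hψ
    (fun x z => gramDensity (β x z))
    (fun x => continuous_gramDensity.comp_continuousOn (hβ x).continuousOn)
    (fun x w hw => gramDensity_pos ((hβ x).injective w hw))
    (fun x y => (hβ x).preservesPlaques (hβ y) mdifferentiable_id one_ne_zero
      -- The identity, with factor 1, is obtained as the zeroth iterate.
      (by simpa using (pullTwoForm_iterate η hf hfη 0).2))
    (fun x y => (hβ x).preservesPlaques (hβ y) hf ha.1.ne' hfη) hbpos
    (fun k x y => by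
      obtain ⟨h1, h2⟩ := pullTwoForm_iterate η hf' hfη' k
      have h3 := (hβ x).scalesTransverseDensity (hβ y) h1 (pow_nonneg ha0.le k) h2
      have h4 : √(a⁻¹ ^ k) ^ Module.finrank ℝ T = b ^ k := by
        have : √(a⁻¹ ^ k) = √a⁻¹ ^ k := by
          rw [Real.sqrt_eq_iff_mul_self_eq (by positivity) (by positivity), ← mul_pow,
            Real.mul_self_sqrt ha0.le]
        rw [this, hb, ← pow_mul, ← pow_mul, mul_comm]
      rwa [h4] at h3)
  refine le_trans (le_of_eq ?_) (log_le_coverEntropy_of_mul_pow_le_card hV hκ hbpos hcard)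
  rw [hb, Real.log_pow, Real.log_sqrt ha0.le, Real.log_inv,
    abs_of_neg (Real.log_neg ha.1 ha.2)]
  congr 1
  ring

end EntropyBound

/-! ### Restriction to the invariant submanifold -/

namespace ConformallySymplectic

variable {d : ℕ} {M : Type*} [TopologicalSpace M]
  [ChartedSpace (EuclideanSpace ℝ (Fin (2 * d))) M]

/-- Pulling Ω back by f ∘ f⁻¹ = id, the chain rule gives Ω = a (f⁻¹)^* Ω. -/
theorem IsConformallySymplectic.symm {Ω : SymplecticForm d M}
    {f : Diffeomorph (𝓡 (2 * d)) (𝓡 (2 * d)) M M 3} {a : ℝ} (ha : a ≠ 0)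
    (hf : IsConformallySymplectic Ω f a) : IsConformallySymplectic Ω f.symm a⁻¹ := by
  intro x u v
  have hd : MDifferentiable (𝓡 (2 * d)) (𝓡 (2 * d)) f := f.mdifferentiable (by simp)
  have hd' : MDifferentiable (𝓡 (2 * d)) (𝓡 (2 * d)) f.symm := f.symm.mdifferentiable (by simp)
  have h1 := pullTwoForm_comp_of_eq Ω.form (hd (f.symm x)) (hd' x) (hf (f.symm x)) u v
  have h2 : f ∘ f.symm =ᶠ[𝓝 x] id := Eventually.of_forall f.apply_symm_apply
  have h3 := (pullTwoForm_congr Ω.form h2 u v).symm.trans h1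
  have h4 : pullTwoForm (𝓡 (2 * d)) (𝓡 (2 * d)) Ω.form id x u v = Ω.form x ![u, v] := by
    simp only [pullTwoForm, mfderiv_id]
    rfl
  rw [h4] at h3
  rw [h3, inv_mul_cancel_left₀ ha]
  rfl

variable {n : ℕ} {N : Set M} [ChartedSpace (EuclideanSpace ℝ (Fin n)) N]

theorem inducedForm_apply (Ω : SymplecticForm d M) (x : N) (u v : TangentSpace (𝓡 n) x) :
    inducedForm Ω n N x ![u, v] =
      pullTwoForm (𝓡 n) (𝓡 (2 * d)) Ω.form (Subtype.val : N → M) x u v := by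
  unfold inducedForm pullTwoForm
  have h : ⇑(mfderiv (𝓡 n) (𝓡 (2 * d)) (Subtype.val : N → M) x) ∘ ![u, v] =
      ![mfderiv (𝓡 n) (𝓡 (2 * d)) (Subtype.val : N → M) x u,
        mfderiv (𝓡 n) (𝓡 (2 * d)) (Subtype.val : N → M) x v] := by
    funext i; fin_cases i <;> rfl
  rw [ContinuousAlternatingMap.compContinuousLinearMap_apply, h]

theorem IsSubmanifold.contMDiff_val (hN : IsSubmanifold d 3 n N) :
    ContMDiff (𝓡 n) (𝓡 (2 * d)) 3 (Subtype.val : N → M) :=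
  hN.isSmoothEmbedding.contMDiff

theorem IsSubmanifold.pullTwoForm_inducedForm (hN : IsSubmanifold d 3 n N)
    (Ω : SymplecticForm d M) {E : Type*} [NormedAddCommGroup E] [NormedSpace ℝ E]
    {H : Type*} [TopologicalSpace H] {I : ModelWithCorners ℝ E H}
    {X : Type*} [TopologicalSpace X] [ChartedSpace H X] {F : X → N} {x : X}
    (hF : MDifferentiableAt I (𝓡 n) F x) (u v : TangentSpace I x) :
    pullTwoForm I (𝓡 n) (inducedForm Ω n N) F x u v =
      pullTwoForm I (𝓡 (2 * d)) Ω.form (Subtype.val ∘ F) x u v := by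
  rw [pullTwoForm_comp Ω.form (hN.contMDiff_val.mdifferentiable (by simp) _) hF]
  exact inducedForm_apply Ω _ _ _

/-- The inclusion is an immersion, so regularity of the continuous map `G` can be tested after
composing with it, where it is that of `g` along `N`. -/
theorem IsSubmanifold.contMDiff_of_val_comp_eq (hN : IsSubmanifold d 3 n N) {g : M → M}
    (hg : ContMDiff (𝓡 (2 * d)) (𝓡 (2 * d)) 3 g) {G : N → N} (hG : ∀ x, (G x : M) = g x) :
    ContMDiff (𝓡 n) (𝓡 n) 3 G := by
  have h1 : Subtype.val ∘ G = g ∘ Subtype.val := funext hG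
  have h2 : ContMDiff (𝓡 n) (𝓡 (2 * d)) 3 (Subtype.val ∘ G) := by
    rw [h1]; exact hg.comp hN.contMDiff_val
  exact (ContMDiff.iff_comp_isImmersion hN.isSmoothEmbedding.isImmersion).2
    ⟨continuous_induced_rng.2 h2.continuous, h2⟩

theorem IsSubmanifold.pullTwoForm_inducedForm_of_conformal (hN : IsSubmanifold d 3 n N)
    {Ω : SymplecticForm d M} {g : M → M} (hg : ContMDiff (𝓡 (2 * d)) (𝓡 (2 * d)) 3 g) {c : ℝ}
    (hgc : IsConformallySymplectic Ω g c) {G : N → N} (hG : ∀ x, (G x : M) = g x)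
    (x : N) (u v : TangentSpace (𝓡 n) x) :
    pullTwoForm (𝓡 n) (𝓡 n) (inducedForm Ω n N) G x u v = c * inducedForm Ω n N x ![u, v] := by
  have h1 : Subtype.val ∘ G = g ∘ Subtype.val := funext hG
  rw [hN.pullTwoForm_inducedForm Ω
    ((hN.contMDiff_of_val_comp_eq hg hG).mdifferentiable (by simp) x), h1,
    pullTwoForm_comp_of_eq Ω.form (hg.mdifferentiable (by simp) _)
      (hN.contMDiff_val.mdifferentiable (by simp) _) (hgc _), inducedForm_apply]

theorem IsSubmanifold.exists_isAdaptedChart [IsManifold (𝓡 (2 * d)) ∞ M]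
    {P T : Type*} [NormedAddCommGroup P] [NormedSpace ℝ P] [FiniteDimensional ℝ P]
    [NormedAddCommGroup T] [NormedSpace ℝ T] [FiniteDimensional ℝ T]
    (hN : IsSubmanifold d 3 n N) {Ω : SymplecticForm d M}
    (hrank : ∀ x : N, formRank (inducedForm Ω n N x) = Module.finrank ℝ T)
    (hdim : Module.finrank ℝ P + Module.finrank ℝ T = n) (x : N) :
    ∃ (ψ : OpenPartialHomeomorph N (P × T)) (β : P × T → T →L[ℝ] T →L[ℝ] ℝ),
      x ∈ ψ.source ∧ IsAdaptedChart (𝓡 n) (inducedForm Ω n N) ψ β := by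
  have := hN.isManifold
  have : IsManifold (𝓡 n) 1 N := IsManifold.of_le (n := 3) (by norm_num)
  set e := chartAt (EuclideanSpace ℝ (Fin n)) x
  have hy : e x ∈ e.target := mem_chart_target _ x
  have hF : ContMDiffAt (𝓡 n) (𝓡 (2 * d)) 3 (Subtype.val ∘ e.symm) (e x) :=
    hN.contMDiff_val.contMDiffAt.comp _
      ((contMDiffOn_chart_symm (I := 𝓡 n) (n := 3) (x := x)).contMDiffAt
        (e.open_target.mem_nhds hy))
  obtain ⟨α, hα, hanti, hcl, hpull⟩ := Ω.exists_local_pullback hF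
  refine exists_isAdaptedChart_of_chart hα hanti hcl ?_ hrank (by simpa using hdim)
  filter_upwards [hpull, e.open_target.mem_nhds hy] with y hy hyt u v
  rw [← hy u v]
  exact hN.pullTwoForm_inducedForm Ω
    (mdifferentiableAt_atlas_symm (chart_mem_atlas _ x) hyt) u v

end ConformallySymplectic

end

/-! ### The main theorem -/

theorem mainTheorem5 {d : ℕ} {M : Type*} [TopologicalSpace M] [T2Space M]
    [ChartedSpace (EuclideanSpace ℝ (Fin (2 * d))) M] [IsManifold (𝓡 (2 * d)) ∞ M]
    (Ω : ConformallySymplectic.SymplecticForm d M)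
    (f : Diffeomorph (𝓡 (2 * d)) (𝓡 (2 * d)) M M 3)
    (a : ℝ) (ha : a ∈ Set.Ioo (0 : ℝ) 1)
    (hf : ConformallySymplectic.IsConformallySymplectic Ω f a)
    {n : ℕ} (N : Set M) [Nonempty N] [CompactSpace N]
    [ChartedSpace (EuclideanSpace ℝ (Fin n)) N]
    (hN : ConformallySymplectic.IsSubmanifold d 3 n N)
    (hinv : f '' N = N)
    (r : ℕ)
    (hr : ∀ x : N, ConformallySymplectic.formRank
      (ConformallySymplectic.inducedForm Ω n N x) = r) :
    (((r : ℝ) / 2 * |Real.log a| : ℝ) : EReal) ≤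
        ConformallySymplectic.topEntropy
          (ConformallySymplectic.restrictInvariant f N hinv) ∧
      (ConformallySymplectic.topEntropy
          (ConformallySymplectic.restrictInvariant f N hinv) = 0 →
        ConformallySymplectic.IsIsotropic Ω n N) := by
  have hrange : ∀ x : N, Module.finrank ℝ (LinearMap.range
      (alternatingToBilin (EuclideanSpace ℝ (Fin n))
        (ConformallySymplectic.inducedForm Ω n N x) :
        EuclideanSpace ℝ (Fin n) →ₗ[ℝ] EuclideanSpace ℝ (Fin n) →L[ℝ] ℝ)) = r := fun x =>
    (formRank_eq_finrank_range (E := EuclideanSpace ℝ (Fin n))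
      (ConformallySymplectic.inducedForm Ω n N x)).symm.trans (hr x)
  have hrn : r ≤ n := by
    obtain ⟨x⟩ := ‹Nonempty N›
    rw [← hrange x]
    exact (LinearMap.finrank_range_le _).trans (by simp)
  have hentropy : (((r : ℝ) / 2 * |Real.log a| : ℝ) : EReal) ≤
      ConformallySymplectic.topEntropy
        (ConformallySymplectic.restrictInvariant f N hinv) := by
    have hmem : ∀ x ∈ N, f.symm x ∈ N := by
      intro x hx
      rw [← hinv] at hx
      obtain ⟨y, hy, rfl⟩ := hx
      rwa [f.symm_apply_apply]
    let G : N → N := ConformallySymplectic.restrictInvariant f N hinv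
    let G' : N → N := fun x => ⟨f.symm x, hmem x x.2⟩
    have hG := hN.contMDiff_of_val_comp_eq f.contMDiff (G := G) fun _ => rfl
    have hG' := hN.contMDiff_of_val_comp_eq f.symm.contMDiff (G := G') fun _ => rfl
    let φ : N ≃ₜ N :=
      { toFun := G
        invFun := G'
        left_inv := fun x => Subtype.ext (f.symm_apply_apply x)
        right_inv := fun x => Subtype.ext (f.apply_symm_apply x)
        continuous_toFun := hG.continuous
        continuous_invFun := hG'.continuous }
    have hcharts := hN.exists_isAdaptedChart (P := EuclideanSpace ℝ (Fin (n - r)))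
      (T := EuclideanSpace ℝ (Fin r)) (Ω := Ω) (fun x => by rw [hr x]; simp)
      (by simp only [finrank_euclideanSpace, Fintype.card_fin]; omega)
    -- The uniform structure is passed explicitly, to match the one in the definition of
    -- `topEntropy`.
    have h := @le_coverEntropy_of_pullTwoForm_eq _ _ _ N uniformSpaceOfCompactR1 _ _ _ _
      _ _ _ _ _ _ _ _ hcharts φ (hG.mdifferentiable (by simp)) (hG'.mdifferentiable (by simp)) a ha
      (hN.pullTwoForm_inducedForm_of_conformal f.contMDiff hf fun _ => rfl)
      (hN.pullTwoForm_inducedForm_of_conformal f.symm.contMDiff (hf.symm ha.1.ne') fun _ => rfl)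
    rw [finrank_euclideanSpace, Fintype.card_fin] at h
    exact h
  refine ⟨hentropy, fun h0 x u v => ?_⟩
  rw [h0, EReal.coe_nonpos] at hentropy
  have hlog : 0 < |Real.log a| := abs_pos.2 (Real.log_neg ha.1 ha.2).ne
  -- A positive rank would make the lower bound for the entropy positive, since log a ≠ 0.
  have hr0 : r = 0 := by
    by_contra h
    have : (0 : ℝ) < r := by exact_mod_cast Nat.pos_of_ne_zero h
    have : 0 < (r : ℝ) / 2 * |Real.log a| := by positivity
    linarith
  have hx := hrange x
  rw [hr0, Submodule.finrank_eq_zero, LinearMap.range_eq_bot] at hx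
  exact (alternatingToBilin_apply (E := EuclideanSpace ℝ (Fin n))
    (ConformallySymplectic.inducedForm Ω n N x) u v).symm.trans
    (DFunLike.congr_fun (DFunLike.congr_fun hx u) v)
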